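/- **Theorem 2.1.** Let $H_n$, $n=0,1,\ldots$, be the Hermite polynomials normalized by $\lim_{x\to\infty}x^{-n}H_n(x)=2^n$, i.e. $H_n(x)=(-1)^ne^{x^2}\frac{d^n}{dx^n}e^{-x^2}$, and put $H_n^{(1)}(x)=e^{-x^2/2}H_n(x)$. Then, for every $n\ge 0$ and every $x\in\mathbb R$, the Hilbert transform $$G_n(x)=\frac1\pi\,\mathrm{p.v.}\!\int_{-\infty}^{\infty}\frac{H_n^{(1)}(t)\,dt}{t-x}$$ exists (as a Cauchy principal value at $t=x$). The functions $G_n$, $n=0,1,\ldots$, form a complete orthogonal system in the real space $L^2(-\infty,\infty)$ (that is, they are nonzero and pairwise orthogonal in $L^2$, and their linear span is dense in $L^2$), and $$\int_{-\infty}^{\infty}G_n(x)G_m(x)\,dx=\sqrt{\pi}\,2^n\,n!\,\delta_{mn},\qquad m,n=0,1,\ldots,$$ where $\delta_{mn}$ is the Kronecker symbol. Moreover, for all $m=0,1,\ldots$ and $x\in\mathbb R$, $$G_{2m}(x)=-\sqrt2\,(2m)!\,x\,e^{-x^2/2}\sum_{k=0}^m\frac{(-1)^k2^k\,\Phi(1/2-k,3/2;x^2/2)}{(m-k)!\,\Gamma(k+1/2)},$$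 $$G_{2m+1}(x)=\sqrt2\,(2m+1)!\,e^{-x^2/2}\sum_{k=0}^m\frac{(-1)^k2^k\,\Phi(-1/2-k,1/2;x^2/2)}{(m-k)!\,\Gamma(k+3/2)}.$$ Here $\Phi$ is the confluent hypergeometric function $$\Phi(a,c;x)=\sum_{k=0}^\infty\frac{(a)_k\,x^k}{(c)_k\,k!},\qquad (a)_k=a(a+1)\cdots(a+k-1),\quad (a)_0=1.$$ -/

import Mathlib

open Filter Topology MeasureTheory

noncomputable section

/-- The Hermite polynomial `H_n` in the physicists' normalization (leading coefficient `2 ^ n`),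
`H_n(x) = 2 ^ (n / 2) * He_n(√2 * x)`, where `He_n` is Mathlib's monic (probabilists') Hermite
polynomial. -/
def hermiteH (n : ℕ) (x : ℝ) : ℝ :=
  (√2) ^ n * Polynomial.aeval (√2 * x) (Polynomial.hermite n)

/-- Rodrigues' formula `H_n(x) = (-1)^n e^{x²} (d/dx)^n e^{-x²}`. -/
theorem hermiteH_eq_rodrigues (n : ℕ) (x : ℝ) :
    hermiteH n x =
      (-1) ^ n * Real.exp (x ^ 2) * iteratedDeriv n (fun t : ℝ => Real.exp (-t ^ 2)) x := by
  have h2 : (√2 : ℝ) ^ 2 = 2 := Real.sq_sqrt (by norm_num)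
  have hf : (fun t : ℝ => Real.exp (-t ^ 2)) =
      fun t : ℝ => (fun y : ℝ => Real.exp (-(y ^ 2 / 2))) (√2 * t) := by
    funext t
    simp only [mul_pow, h2]
    congr 1
    ring
  have hs : ContDiff ℝ n (fun y : ℝ => Real.exp (-(y ^ 2 / 2))) := by fun_prop
  rw [hf, iteratedDeriv_comp_const_mul hs]
  simp only [iteratedDeriv_eq_iterate]
  rw [hermiteH, Polynomial.hermite_eq_deriv_gaussian', mul_pow, h2]
  rw [show (2 : ℝ) * x ^ 2 / 2 = x ^ 2 by ring]
  ring

/-- The normalization `x^{-n} H_n(x) → 2^n` as `x → ∞`. -/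
theorem tendsto_hermiteH (n : ℕ) :
    Tendsto (fun x : ℝ => (x ^ n)⁻¹ * hermiteH n x) atTop (𝓝 (2 ^ n)) := by
  have h0 : (0 : ℝ) < √2 := by positivity
  have h2 : (√2 : ℝ) * √2 = 2 := Real.mul_self_sqrt (by norm_num)
  have hinj : Function.Injective (Int.castRingHom ℝ) := Int.cast_injective
  have hdeg : ((Polynomial.hermite n).map (Int.castRingHom ℝ)).degree =
      ((Polynomial.X : Polynomial ℝ) ^ n).degree := by
    rw [Polynomial.degree_map_eq_of_injective hinj, Polynomial.degree_hermite,
      Polynomial.degree_X_pow]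
  have h := Polynomial.div_tendsto_atTop_leadingCoeff_div_of_degree_eq _ _ hdeg
  rw [((Polynomial.hermite_monic n).map _).leadingCoeff,
    (Polynomial.monic_X_pow n).leadingCoeff, div_one] at h
  have h' := (h.comp (tendsto_id.const_mul_atTop h0)).const_mul ((2 : ℝ) ^ n)
  rw [mul_one] at h'
  refine h'.congr fun x => ?_
  simp only [Function.comp_apply, Polynomial.eval_map, Polynomial.eval_pow, Polynomial.eval_X,
    hermiteH, Polynomial.aeval_def, id_eq, mul_pow, algebraMap_int_eq]
  have hp : (2 : ℝ) ^ n = √2 ^ n * √2 ^ n := by rw [← mul_pow, h2]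
  have hn : (√2 : ℝ) ^ n ≠ 0 := by positivity
  rw [hp]
  generalize (√2 : ℝ) ^ n = s at hn ⊢
  rw [div_eq_mul_inv, mul_inv]
  field_simp

/-- The Hermite function `H_n^{(1)}(x) = exp(-x² / 2) H_n(x)`. -/
def hermiteFun (n : ℕ) (x : ℝ) : ℝ := Real.exp (-x ^ 2 / 2) * hermiteH n x

/-- `HasHilbertTransformAt φ x g`: the singular integral `(1/π) ∫ φ(t) / (t - x) dt` exists as a
Cauchy principal value at `t = x`, with value `g`. The integrals over `{t | ε < |t - x|}` are
required to converge absolutely, as they do for every square-integrable `φ`. -/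
def HasHilbertTransformAt (φ : ℝ → ℝ) (x g : ℝ) : Prop :=
  (∀ ε : ℝ, 0 < ε → IntegrableOn (fun t => φ t / (t - x)) {t | ε < |t - x|}) ∧
    Tendsto (fun ε : ℝ => 1 / Real.pi * ∫ t in {t | ε < |t - x|}, φ t / (t - x))
      (𝓝[>] 0) (𝓝 g)

/-- The Hilbert transform `H[φ](x) = (1/π) p.v.∫ φ(t) / (t - x) dt`; it is meaningful at the
points `x` at which `HasHilbertTransformAt φ x` holds for some value. -/
def hilbertTransform (φ : ℝ → ℝ) (x : ℝ) : ℝ :=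
  limUnder (𝓝[>] 0)
    (fun ε : ℝ => 1 / Real.pi * ∫ t in {t | ε < |t - x|}, φ t / (t - x))

theorem HasHilbertTransformAt.hilbertTransform_eq {φ : ℝ → ℝ} {x g : ℝ}
    (h : HasHilbertTransformAt φ x g) : hilbertTransform φ x = g :=
  h.2.limUnder_eq

/-- The `G`-functions: the Hilbert transforms of the Hermite functions. -/
def hermiteG (n : ℕ) : ℝ → ℝ := hilbertTransform (hermiteFun n)

/-- A complete orthogonal system in the real space `L²(ℝ)`: square-integrable functions whose
classes are nonzero, pairwise orthogonal, and have dense linear span. -/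
def IsCompleteOrthogonalSystem (f : ℕ → ℝ → ℝ) : Prop :=
  ∃ hf : ∀ n, MemLp (f n) 2 (volume : Measure ℝ),
    (∀ n, (hf n).toLp (f n) ≠ 0) ∧
    (∀ m n, m ≠ n → inner ℝ ((hf m).toLp (f m)) ((hf n).toLp (f n)) = 0) ∧
    (Submodule.span ℝ (Set.range fun n => (hf n).toLp (f n))).topologicalClosure = ⊤

/-- The `k`-th term `(a)_k x^k / ((c)_k k!)` of the confluent hypergeometric series, where
`(a)_k = a (a + 1) ⋯ (a + k - 1)`. -/
def confluentTerm (a c x : ℝ) (k : ℕ) : ℝ :=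
  (ascPochhammer ℝ k).eval a * x ^ k / ((ascPochhammer ℝ k).eval c * (k.factorial : ℝ))

/-- The confluent hypergeometric function `Φ(a, c; x) = ∑ (a)_k x^k / ((c)_k k!)`. -/
def confluentPhi (a c x : ℝ) : ℝ := ∑' k : ℕ, confluentTerm a c x k

/-- The series that defines `Φ(a, c; x)` always converges. -/
theorem summable_confluentTerm (a c x : ℝ) : Summable (confluentTerm a c x) := by
  have hrec : ∀ k : ℕ, confluentTerm a c x (k + 1) =
      ((a + k) / (c + k)) * (x / ((k : ℝ) + 1)) * confluentTerm a c x k := by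
    intro k
    simp only [confluentTerm, ascPochhammer_succ_eval, Nat.factorial_succ, Nat.cast_mul,
      Nat.cast_add, Nat.cast_one, pow_succ, div_eq_mul_inv, mul_inv]
    ring
  have h1 : Tendsto (fun k : ℕ => (a + k) / (c + k)) atTop (𝓝 (1 : ℝ)) := by
    have ht : Tendsto (fun k : ℕ => c + (k : ℝ)) atTop atTop :=
      tendsto_atTop_add_const_left _ _ tendsto_natCast_atTop_atTop
    have h := (ht.inv_tendsto_atTop.const_mul (a - c)).const_add 1
    rw [mul_zero, add_zero] at h
    refine h.congr' ?_
    filter_upwards [ht.eventually_gt_atTop 0] with k hk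
    have : c + (k : ℝ) ≠ 0 := hk.ne'
    simp only [Pi.inv_apply]
    field_simp
    ring
  have h2 : Tendsto (fun k : ℕ => x / ((k : ℝ) + 1)) atTop (𝓝 0) :=
    (tendsto_atTop_add_const_right _ _ tendsto_natCast_atTop_atTop).const_div_atTop x
  have h3 := (h1.mul h2).norm
  rw [mul_zero, norm_zero] at h3
  refine summable_of_ratio_norm_eventually_le (r := 1 / 2) (by norm_num) ?_
  filter_upwards [h3.eventually_le_const (show (0 : ℝ) < 1 / 2 by norm_num)] with k hk
  rw [hrec, norm_mul]
  exact mul_le_mul_of_nonneg_right hk (norm_nonneg _)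

end

/-! Write h_n for `hermiteFun n`. The Hermite functions are eigenfunctions of the Fourier transform,
and the Hilbert transform multiplies Fourier transforms by a unimodular multiple of the sign
function. So the transform of h_n should be √(2/π) Re((-i)^n i ∫_0^∞ h_n(u) e^{ixu} du), which is
`hermiteHilbert`. The principal value, the explicit formulas and the L² statements are all reached
through this expression.

That it is the pointwise principal value (`hasHilbertTransformAt_hermiteFun`) follows by two-step
induction. For n = 0 the symmetric differences of the Gaussian give a sinh integral, and Kummer's
transformation identifies it with the required sine integral. Multiplication by t commutes with the
Hilbert transform up to the total mass of the function, so the three-term recurrence for h_n passes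
to the principal values. Integration by parts gives the same recurrence for the half-line Fourier
integrals: the boundary value h_{n+1}(0) matches the total mass of h_{n+1}, by the eigenfunction
property at the origin (`integral_hermiteFun`).

For the explicit formulas, H_n is expanded in powers. Each resulting sine or cosine integral against
the Gaussian is a confluent series, and Kummer's transformation brings it to the stated form.

For L², `fourierInv_hermiteSymbol` writes the transform of h_n as the inverse Fourier integral of a
phase times sign(v) h_n(2πv). Plancherel reduces orthogonality and norms to those of h_n. A function
orthogonal to every transform has a Fourier transform which, multiplied by the sign, is orthogonal
to all dilated Hermite functions. It therefore vanishes, by the moment argument in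
`ae_eq_zero_of_integral_hermiteFun_mul_eq_zero`. -/

/-! ### Hermite functions: recurrences, integrability, orthogonality. -/

theorem derivative_hermite_succ (n : ℕ) :
    Polynomial.derivative (Polynomial.hermite (n + 1)) =
      ((n : Polynomial ℤ) + 1) * Polynomial.hermite n := by
  induction n with
  | zero => simp [Polynomial.hermite_succ]
  | succ n ih =>
    rw [Polynomial.hermite_succ (n + 1), ih]
    simp only [Polynomial.derivative_sub, Polynomial.derivative_mul, Polynomial.derivative_X, ih,
      Polynomial.derivative_add, Polynomial.derivative_natCast, Polynomial.derivative_one]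
    rw [Polynomial.hermite_succ n]
    push_cast
    ring

theorem hermiteH_zero (x : ℝ) : hermiteH 0 x = 1 := by simp [hermiteH]

theorem hermiteH_one (x : ℝ) : hermiteH 1 x = 2 * x := by
  simp only [hermiteH, Polynomial.hermite_one, Polynomial.aeval_X, pow_one]
  rw [← mul_assoc, Real.mul_self_sqrt (by norm_num)]

theorem hermiteH_add_two (n : ℕ) (x : ℝ) :
    hermiteH (n + 2) x = 2 * x * hermiteH (n + 1) x - 2 * (n + 1) * hermiteH n x := by
  have h2 : (√2 : ℝ) ^ 2 = 2 := Real.sq_sqrt (by norm_num)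
  simp only [hermiteH]
  rw [Polynomial.hermite_succ (n + 1), derivative_hermite_succ]
  simp only [map_sub, map_mul, Polynomial.aeval_X, map_add, map_natCast, map_one]
  linear_combination (√2 ^ n * √2 * x * (Polynomial.aeval (√2 * x)) (Polynomial.hermite (n + 1)) -
    √2 ^ n * (n + 1) * (Polynomial.aeval (√2 * x)) (Polynomial.hermite n)) * h2

theorem hasDerivAt_hermiteH_succ (n : ℕ) (x : ℝ) :
    HasDerivAt (hermiteH (n + 1)) (2 * (n + 1) * hermiteH n x) x := by
  have h2 : (√2 : ℝ) ^ 2 = 2 := Real.sq_sqrt (by norm_num)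
  have h := (((Polynomial.hermite (n + 1)).hasDerivAt_aeval (√2 * x)).comp x
    ((hasDerivAt_id x).const_mul √2)).const_mul (√2 ^ (n + 1))
  refine h.congr_deriv ?_
  rw [derivative_hermite_succ]
  simp only [map_mul, map_add, map_natCast, map_one, hermiteH]
  linear_combination (√2 ^ n * (n + 1) * (Polynomial.aeval (√2 * x)) (Polynomial.hermite n)) * h2

theorem hermiteFun_zero (x : ℝ) : hermiteFun 0 x = Real.exp (-x ^ 2 / 2) := by
  simp [hermiteFun, hermiteH_zero]

theorem hermiteFun_one (x : ℝ) : hermiteFun 1 x = 2 * x * hermiteFun 0 x := by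
  simp only [hermiteFun, hermiteH_zero, hermiteH_one]; ring

theorem hermiteFun_add_two (n : ℕ) (x : ℝ) :
    hermiteFun (n + 2) x = 2 * x * hermiteFun (n + 1) x - 2 * (n + 1) * hermiteFun n x := by
  simp only [hermiteFun, hermiteH_add_two]; ring

theorem hasDerivAt_gaussian_half (x : ℝ) :
    HasDerivAt (fun t : ℝ => Real.exp (-t ^ 2 / 2)) (-x * Real.exp (-x ^ 2 / 2)) x := by
  have h : HasDerivAt (fun t : ℝ => -t ^ 2 / 2) (-x) x := by
    refine (((hasDerivAt_pow 2 x).neg).div_const 2).congr_deriv ?_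
    norm_num
    ring
  refine h.exp.congr_deriv (by ring)

theorem hasDerivAt_hermiteFun_zero (x : ℝ) :
    HasDerivAt (hermiteFun 0) (-x * hermiteFun 0 x) x := by
  rw [hermiteFun_zero]
  exact (hasDerivAt_gaussian_half x).congr_of_eventuallyEq
    (Eventually.of_forall hermiteFun_zero)

theorem hasDerivAt_hermiteFun_succ (n : ℕ) (x : ℝ) :
    HasDerivAt (hermiteFun (n + 1))
      (2 * (n + 1) * hermiteFun n x - x * hermiteFun (n + 1) x) x := by
  refine ((hasDerivAt_gaussian_half x).mul (hasDerivAt_hermiteH_succ n x)).congr_deriv ?_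
  simp only [hermiteFun]; ring

/-- The creation operator `x - d/dx` raises the index of a Hermite function. -/
theorem hasDerivAt_hermiteFun (n : ℕ) (x : ℝ) :
    HasDerivAt (hermiteFun n) (x * hermiteFun n x - hermiteFun (n + 1) x) x := by
  cases n with
  | zero =>
    refine (hasDerivAt_hermiteFun_zero x).congr_deriv ?_
    rw [zero_add, hermiteFun_one]; ring
  | succ n =>
    refine (hasDerivAt_hermiteFun_succ n x).congr_deriv ?_
    rw [hermiteFun_add_two]; ring

theorem continuous_hermiteFun (n : ℕ) : Continuous (hermiteFun n) :=
  continuous_iff_continuousAt.2 fun x => (hasDerivAt_hermiteFun n x).continuousAt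

theorem hermiteFun_neg (n : ℕ) (x : ℝ) : hermiteFun n (-x) = (-1) ^ n * hermiteFun n x := by
  induction n using Nat.twoStepInduction with
  | zero => simp [hermiteFun_zero]
  | one => simp [hermiteFun_one, hermiteFun_zero]
  | more n ih1 ih2 => rw [hermiteFun_add_two, hermiteFun_add_two, ih1, ih2]; ring

theorem integrable_pow_mul_gaussian (k : ℕ) {b : ℝ} (hb : 0 < b) :
    Integrable (fun x : ℝ => x ^ k * Real.exp (-b * x ^ 2)) := by
  have h := integrable_rpow_mul_exp_neg_mul_sq hb (s := k)
    (lt_of_lt_of_le (by norm_num) k.cast_nonneg)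
  simpa only [Real.rpow_natCast] using h

/-- The Hermite function already carries exp(-x²/2), whence the threshold -1/2 for b. The power x^k
is kept general to absorb the factor x that the recurrence produces in the induction on n. -/
theorem integrable_pow_mul_hermiteFun_mul_gaussian (n k : ℕ) {b : ℝ} (hb : -(1 / 2) < b) :
    Integrable (fun x : ℝ => x ^ k * hermiteFun n x * Real.exp (-b * x ^ 2)) := by
  induction n using Nat.twoStepInduction generalizing k with
  | zero =>
    refine (integrable_pow_mul_gaussian k (b := b + 1 / 2) (by linarith)).congr ?_
    refine Eventually.of_forall fun x => ?_
    simp only [hermiteFun_zero]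
    rw [mul_assoc, ← Real.exp_add]
    ring_nf
  | one =>
    refine ((integrable_pow_mul_gaussian (k + 1) (b := b + 1 / 2)
      (by linarith)).const_mul 2).congr ?_
    refine Eventually.of_forall fun x => ?_
    simp only [hermiteFun_one, hermiteFun_zero]
    rw [show x ^ k * (2 * x * Real.exp (-x ^ 2 / 2)) * Real.exp (-b * x ^ 2) =
      2 * (x ^ (k + 1) * (Real.exp (-x ^ 2 / 2) * Real.exp (-b * x ^ 2))) by ring,
      ← Real.exp_add]
    ring_nf
  | more n ih1 ih2 =>
    refine (((ih2 (k + 1)).const_mul 2).sub ((ih1 k).const_mul (2 * (n + 1)))).congr ?_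
    refine Eventually.of_forall fun x => ?_
    simp only [hermiteFun_add_two, Pi.sub_apply]
    ring

theorem integrable_pow_mul_hermiteFun (n k : ℕ) :
    Integrable (fun x : ℝ => x ^ k * hermiteFun n x) := by
  simpa using integrable_pow_mul_hermiteFun_mul_gaussian n k (b := 0) (by norm_num)

theorem integrable_hermiteFun (n : ℕ) : Integrable (hermiteFun n) := by
  simpa using integrable_pow_mul_hermiteFun n 0

theorem integrable_pow_mul_hermiteFun_mul_hermiteFun (n m k : ℕ) :
    Integrable (fun x : ℝ => x ^ k * (hermiteFun n x * hermiteFun m x)) := by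
  induction m using Nat.twoStepInduction generalizing k with
  | zero =>
    refine (integrable_pow_mul_hermiteFun_mul_gaussian n k (b := 1 / 2) (by norm_num)).congr ?_
    refine Eventually.of_forall fun x => ?_
    simp only [hermiteFun_zero]
    ring_nf
  | one =>
    refine ((integrable_pow_mul_hermiteFun_mul_gaussian n (k + 1) (b := 1 / 2)
      (by norm_num)).const_mul 2).congr ?_
    refine Eventually.of_forall fun x => ?_
    simp only [hermiteFun_one, hermiteFun_zero]
    ring_nf
  | more m ih1 ih2 =>
    refine (((ih2 (k + 1)).const_mul 2).sub ((ih1 k).const_mul (2 * (m + 1)))).congr ?_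
    refine Eventually.of_forall fun x => ?_
    simp only [hermiteFun_add_two, Pi.sub_apply]
    ring

theorem integrable_hermiteFun_mul_hermiteFun (n m : ℕ) :
    Integrable (fun x : ℝ => hermiteFun n x * hermiteFun m x) := by
  simpa using integrable_pow_mul_hermiteFun_mul_hermiteFun n m 0

/-- The recurrences combine to h_{n+2} = 2(n+1) h_n - 2 h_{n+1}', and the derivative integrates to
zero. -/
theorem integral_hermiteFun_add_two (n : ℕ) :
    ∫ x, hermiteFun (n + 2) x = 2 * (n + 1) * ∫ x, hermiteFun n x := by
  have h1 : Integrable fun x : ℝ => 2 * (n + 1) * hermiteFun n x - x * hermiteFun (n + 1) x :=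
    ((integrable_hermiteFun n).const_mul _).sub (by
      simpa using integrable_pow_mul_hermiteFun (n + 1) 1)
  have h := integral_eq_zero_of_hasDerivAt_of_integrable (hasDerivAt_hermiteFun_succ n) h1
    (integrable_hermiteFun _)
  have h2 : ∀ x, hermiteFun (n + 2) x = 2 * (n + 1) * hermiteFun n x -
      2 * (2 * (n + 1) * hermiteFun n x - x * hermiteFun (n + 1) x) := fun x => by
    rw [hermiteFun_add_two]; ring
  simp_rw [h2]
  rw [integral_sub ((integrable_hermiteFun n).const_mul _) (h1.const_mul 2),
    integral_const_mul, integral_const_mul, h]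
  ring

theorem integral_gaussian_half : ∫ x : ℝ, Real.exp (-x ^ 2 / 2) = √(2 * Real.pi) := by
  have h := integral_gaussian (1 / 2)
  rw [show Real.pi / (1 / 2) = 2 * Real.pi by ring] at h
  rw [← h]
  congr 1 with x
  ring_nf

/-- At the origin the Hermite functions are eigenfunctions of the Fourier transform. -/
theorem integral_hermiteFun (n : ℕ) :
    ∫ x, hermiteFun n x = √(2 * Real.pi) * hermiteFun n 0 * ((-Complex.I) ^ n).re := by
  induction n using Nat.twoStepInduction with
  | zero => simp [hermiteFun_zero, integral_gaussian_half]
  | one =>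
    have h : ∀ x, 2 * x * hermiteFun 0 x = (-2) * (-x * hermiteFun 0 x) := fun x => by ring
    simp_rw [hermiteFun_one, h]
    rw [integral_const_mul, integral_eq_zero_of_hasDerivAt_of_integrable
      hasDerivAt_hermiteFun_zero _ (integrable_hermiteFun 0)]
    · simp
    · simpa using (integrable_pow_mul_hermiteFun 0 1).neg
  | more n ih1 ih2 =>
    rw [integral_hermiteFun_add_two, ih1, hermiteFun_add_two, pow_add]
    simp
    ring

/-- Integration by parts: the adjoint of the creation operator x - d/dx is the annihilation operator
x + d/dx. -/
theorem integral_hermiteFun_succ_mul (n : ℕ) {g g' : ℝ → ℝ} (hg : ∀ x, HasDerivAt g (g' x) x)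
    (h0 : Integrable fun x => hermiteFun n x * g x)
    (h1 : Integrable fun x => hermiteFun (n + 1) x * g x)
    (h2 : Integrable fun x => hermiteFun n x * (x * g x))
    (h3 : Integrable fun x => hermiteFun n x * g' x) :
    ∫ x, hermiteFun (n + 1) x * g x = ∫ x, hermiteFun n x * (x * g x + g' x) := by
  have hd : ∀ x, HasDerivAt (fun x => hermiteFun n x * g x)
      (hermiteFun n x * (x * g x) + hermiteFun n x * g' x - hermiteFun (n + 1) x * g x) x :=
    fun x => ((hasDerivAt_hermiteFun n x).mul (hg x)).congr_deriv (by ring)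
  have h := integral_eq_zero_of_hasDerivAt_of_integrable hd ((h2.add h3).sub h1) h0
  have h23 : Integrable fun x => hermiteFun n x * (x * g x) + hermiteFun n x * g' x := h2.add h3
  rw [integral_sub h23 h1] at h
  simp_rw [mul_add]
  linarith

/-- The annihilation operator kills h_0 and sends h_{m+1} to 2(m+1) h_m, so moving a creation
operator across lowers both indices together until one of them is 0. -/
theorem integral_hermiteFun_mul_hermiteFun (n m : ℕ) :
    ∫ x, hermiteFun n x * hermiteFun m x =
      if m = n then √Real.pi * 2 ^ n * (n.factorial : ℝ) else 0 := by
  have hx : ∀ n m, Integrable fun x => hermiteFun n x * (x * hermiteFun m x) := fun n m => by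
    refine (integrable_pow_mul_hermiteFun_mul_hermiteFun n m 1).congr
      (Eventually.of_forall fun x => ?_)
    simp only [pow_one]; ring
  induction n generalizing m with
  | zero =>
    cases m with
    | zero =>
      have h := integral_gaussian 1
      simp only [hermiteFun_zero, ← Real.exp_add]
      simp only [div_one] at h
      simp only [if_true, pow_zero, Nat.factorial_zero, Nat.cast_one, mul_one, ← h]
      congr 1 with x
      ring_nf
    | succ m =>
      simp only [Nat.succ_ne_zero, if_false]
      simp_rw [mul_comm (hermiteFun 0 _)]
      rw [integral_hermiteFun_succ_mul m hasDerivAt_hermiteFun_zero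
        (integrable_hermiteFun_mul_hermiteFun _ _) (integrable_hermiteFun_mul_hermiteFun _ _)
        (hx _ _)]
      · simp
      · refine (hx m 0).neg.congr (Eventually.of_forall fun x => ?_)
        simp
  | succ n ih =>
    cases m with
    | zero =>
      simp only [(Nat.succ_ne_zero n).symm, if_false]
      rw [integral_hermiteFun_succ_mul n hasDerivAt_hermiteFun_zero
        (integrable_hermiteFun_mul_hermiteFun _ _) (integrable_hermiteFun_mul_hermiteFun _ _)
        (hx _ _)]
      · simp
      · refine (hx n 0).neg.congr (Eventually.of_forall fun x => ?_)
        simp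
    | succ m =>
      rw [integral_hermiteFun_succ_mul n (hasDerivAt_hermiteFun_succ m)
        (integrable_hermiteFun_mul_hermiteFun _ _) (integrable_hermiteFun_mul_hermiteFun _ _)
        (hx _ _)]
      · have : ∀ x, hermiteFun n x * (x * hermiteFun (m + 1) x + (2 * (m + 1) * hermiteFun m x -
            x * hermiteFun (m + 1) x)) = 2 * (m + 1) * (hermiteFun n x * hermiteFun m x) :=
          fun x => by ring
        simp_rw [this]
        rw [integral_const_mul, ih]
        by_cases hmn : m = n
        · subst hmn
          simp only [if_true, Nat.factorial_succ]
          push_cast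
          ring
        · simp [hmn]
      · refine (((integrable_hermiteFun_mul_hermiteFun n m).const_mul (2 * (m + 1))).sub
          (hx n (m + 1))).congr (Eventually.of_forall fun x => ?_)
        simp only [Pi.sub_apply]; ring

/-! ### Pochhammer identities and Kummer's transformation. -/

theorem ascPochhammer_eval_pos {c : ℝ} (hc : 0 < c) (k : ℕ) :
    0 < (ascPochhammer ℝ k).eval c := ascPochhammer_pos k c hc

theorem ascPochhammer_succ_eval_left (k : ℕ) (a : ℝ) :
    (ascPochhammer ℝ (k + 1)).eval a = a * (ascPochhammer ℝ k).eval (a + 1) := by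
  rw [ascPochhammer_succ_left]; simp

/-- The Chu–Vandermonde identity for `₂F₁(-n, a; c; 1)`. -/
theorem sum_choose_mul_ascPochhammer_div (n : ℕ) (a : ℝ) {c : ℝ} (hc : 0 < c) :
    ∑ j ∈ Finset.range (n + 1), (n.choose j : ℝ) * ((-1) ^ j *
      ((ascPochhammer ℝ j).eval a / (ascPochhammer ℝ j).eval c)) =
      (ascPochhammer ℝ n).eval (c - a) / (ascPochhammer ℝ n).eval c := by
  induction n generalizing a c with
  | zero => simp
  | succ n ih =>
    have hc1 := ascPochhammer_eval_pos (show 0 < c + 1 by linarith) n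
    have hcn := ascPochhammer_eval_pos hc n
    have hn : (0 : ℝ) < c + n := by positivity
    have hrel : c * (ascPochhammer ℝ n).eval (c + 1) =
        (ascPochhammer ℝ n).eval c * (c + n) := by
      rw [← ascPochhammer_succ_eval_left, ascPochhammer_succ_eval]
    have hshift : ∀ j : ℕ, (-1 : ℝ) ^ (j + 1) * ((ascPochhammer ℝ (j + 1)).eval a /
        (ascPochhammer ℝ (j + 1)).eval c) = (-(a / c)) * ((-1) ^ j *
        ((ascPochhammer ℝ j).eval (a + 1) / (ascPochhammer ℝ j).eval (c + 1))) := fun j => by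
      rw [ascPochhammer_succ_eval_left, ascPochhammer_succ_eval_left, mul_div_mul_comm, pow_succ]
      ring
    -- Pascal's rule. By `hshift`, the second sum is the same sum at (a + 1, c + 1), so the
    -- induction hypothesis applies to both.
    have hsplit : ∑ j ∈ Finset.range (n + 1 + 1), ((n + 1).choose j : ℝ) * ((-1) ^ j *
        ((ascPochhammer ℝ j).eval a / (ascPochhammer ℝ j).eval c)) =
        ∑ j ∈ Finset.range (n + 1), (n.choose j : ℝ) * ((-1) ^ j *
          ((ascPochhammer ℝ j).eval a / (ascPochhammer ℝ j).eval c)) +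
        ∑ j ∈ Finset.range (n + 1), (n.choose j : ℝ) * ((-1) ^ (j + 1) *
          ((ascPochhammer ℝ (j + 1)).eval a / (ascPochhammer ℝ (j + 1)).eval c)) := by
      rw [Finset.sum_range_succ' _ (n + 1)]
      simp_rw [Nat.choose_succ_succ, Nat.cast_add, add_mul]
      rw [Finset.sum_add_distrib, Finset.sum_range_succ (fun j => ((n.choose (j + 1) : ℕ) : ℝ) * _),
        Finset.sum_range_succ' (fun j => (n.choose j : ℝ) * ((-1) ^ j * _)) n]
      simp
      ring
    rw [hsplit, ih a hc]
    simp_rw [hshift, mul_left_comm _ (-(a / c))]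
    rw [← Finset.mul_sum, ih (a + 1) (show 0 < c + 1 by linarith),
      show c + 1 - (a + 1) = c - a by ring, ascPochhammer_succ_eval, ascPochhammer_succ_eval,
      ← hrel]
    field_simp
    linear_combination ((ascPochhammer ℝ n).eval (c - a)) * hrel

theorem summable_norm_confluentTerm (a c x : ℝ) : Summable fun k => ‖confluentTerm a c x k‖ :=
  (summable_confluentTerm a c x).norm

/-- Kummer's transformation. -/
theorem confluentPhi_kummer (a : ℝ) {c : ℝ} (hc : 0 < c) (x : ℝ) :
    Real.exp x * confluentPhi (c - a) c (-x) = confluentPhi a c x := by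
  have hexp : HasSum (fun n : ℕ => x ^ n / n.factorial) (Real.exp x) := by
    rw [Real.exp_eq_exp_ℝ]; exact NormedSpace.expSeries_div_hasSum_exp x
  rw [mul_comm, ← hexp.tsum_eq, confluentPhi, confluentPhi,
    tsum_mul_tsum_eq_tsum_sum_range_of_summable_norm (summable_norm_confluentTerm _ _ _)
      hexp.summable.norm]
  refine tsum_congr fun n => ?_
  -- The n-th coefficient of the Cauchy product is a Chu–Vandermonde sum with c - a as upper
  -- parameter, which evaluates to (a)_n / (c)_n.
  have h := sum_choose_mul_ascPochhammer_div n (c - a) hc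
  rw [sub_sub_cancel] at h
  have hrw : confluentTerm a c x n = x ^ n / n.factorial *
      ((ascPochhammer ℝ n).eval a / (ascPochhammer ℝ n).eval c) := by
    rw [confluentTerm]; ring
  rw [hrw, ← h, Finset.mul_sum]
  refine Finset.sum_congr rfl fun k hk => ?_
  have hkn : k ≤ n := Nat.lt_succ_iff.1 (Finset.mem_range.1 hk)
  have hck := (ascPochhammer_eval_pos hc k).ne'
  rw [confluentTerm, Nat.cast_choose ℝ hkn, neg_pow x k,
    show x ^ n = x ^ k * x ^ (n - k) by rw [← pow_add, Nat.add_sub_cancel' hkn]]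
  have h1 : (n.factorial : ℝ) ≠ 0 := by positivity
  have h2 : (k.factorial : ℝ) ≠ 0 := by positivity
  have h3 : ((n - k).factorial : ℝ) ≠ 0 := by positivity
  field_simp

theorem ascPochhammer_eval_natCast_add_one (k j : ℕ) :
    (k.factorial : ℝ) * (ascPochhammer ℝ j).eval ((k : ℝ) + 1) = ((k + j).factorial : ℝ) := by
  induction j with
  | zero => simp
  | succ j ih =>
    rw [ascPochhammer_succ_eval, ← mul_assoc, ih, ← add_assoc, Nat.factorial_succ]
    push_cast
    ring

theorem ascPochhammer_eval_half (j : ℕ) :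
    (ascPochhammer ℝ j).eval (1 / 2) * (4 ^ j * j.factorial) = ((2 * j).factorial : ℝ) := by
  induction j with
  | zero => simp
  | succ j ih =>
    rw [ascPochhammer_succ_eval, mul_add 2 j 1, mul_one, Nat.factorial_succ (2 * j + 1),
      Nat.factorial_succ (2 * j), Nat.factorial_succ j]
    push_cast
    rw [← ih]
    ring

theorem ascPochhammer_eval_three_halves (j : ℕ) :
    (ascPochhammer ℝ j).eval (3 / 2) * (4 ^ j * j.factorial) = ((2 * j + 1).factorial : ℝ) := by
  induction j with
  | zero => simp
  | succ j ih =>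
    rw [ascPochhammer_succ_eval, mul_add 2 j 1, mul_one, Nat.factorial_succ (2 * j + 2),
      Nat.factorial_succ (2 * j + 1), Nat.factorial_succ j]
    push_cast
    rw [← ih]
    ring

theorem gamma_natCast_add_half (k : ℕ) :
    Real.Gamma (k + 1 / 2) * (4 ^ k * k.factorial) = √Real.pi * ((2 * k).factorial : ℝ) := by
  induction k with
  | zero => simpa using Real.Gamma_one_half_eq
  | succ k ih =>
    rw [mul_add, mul_one, Nat.factorial_succ (2 * k + 1), Nat.factorial_succ (2 * k),
      Nat.factorial_succ k]
    push_cast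
    rw [show (k : ℝ) + 1 + 1 / 2 = (k + 1 / 2) + 1 by ring, Real.Gamma_add_one (by positivity)]
    linear_combination (4 * (k + 1) * (k + 1 / 2)) * ih

theorem gamma_natCast_add_three_halves (k : ℕ) :
    Real.Gamma (k + 3 / 2) * (2 * 4 ^ k * k.factorial) =
      √Real.pi * ((2 * k + 1).factorial : ℝ) := by
  have h := gamma_natCast_add_half k
  rw [show (k : ℝ) + 3 / 2 = (k + 1 / 2) + 1 by ring, Real.Gamma_add_one (by positivity),
    Nat.factorial_succ (2 * k)]
  push_cast
  linear_combination (2 * k + 1) * h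

/-! ### Power series integrated against the half-line Gaussian. -/

/-- The moments of the Gaussian on the half-line. -/
noncomputable def gaussianMoment (p : ℕ) : ℝ := ∫ u in Set.Ioi (0 : ℝ), u ^ p * Real.exp (-u ^ 2 / 2)

theorem gaussianMoment_eq (p : ℕ) :
    gaussianMoment p = (1 / 2 : ℝ) ^ (-((p : ℝ) + 1) / 2) * (1 / 2) *
      Real.Gamma (((p : ℝ) + 1) / 2) := by
  rw [← integral_rpow_mul_exp_neg_mul_rpow (p := 2) (q := p) (b := 1 / 2) (by norm_num)
    (lt_of_lt_of_le (by norm_num) p.cast_nonneg) (by norm_num), gaussianMoment]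
  refine setIntegral_congr_fun measurableSet_Ioi fun u _ => ?_
  simp only [Real.rpow_natCast, Real.rpow_two]
  ring_nf

theorem gaussianMoment_add_two (p : ℕ) : gaussianMoment (p + 2) = (p + 1) * gaussianMoment p := by
  rw [gaussianMoment_eq, gaussianMoment_eq]
  push_cast
  rw [show -((p : ℝ) + 2 + 1) / 2 = -((p : ℝ) + 1) / 2 - 1 by ring,
    show ((p : ℝ) + 2 + 1) / 2 = ((p : ℝ) + 1) / 2 + 1 by ring,
    Real.rpow_sub_one (by norm_num), Real.Gamma_add_one (by positivity)]
  ring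

theorem gaussianMoment_odd (j : ℕ) : gaussianMoment (2 * j + 1) = 2 ^ j * j.factorial := by
  induction j with
  | zero =>
    rw [gaussianMoment_eq]
    norm_num [Real.rpow_neg_one]
  | succ j ih =>
    rw [mul_add, mul_one, add_right_comm, gaussianMoment_add_two, ih, Nat.factorial_succ]
    push_cast
    ring

theorem gaussianMoment_even (j : ℕ) :
    gaussianMoment (2 * j) = √(Real.pi / 2) * (ascPochhammer ℝ j).eval (1 / 2) * 2 ^ j := by
  induction j with
  | zero =>
    have h := integral_gaussian_Ioi (1 / 2)
    have h2 : √(Real.pi / (1 / 2)) = 2 * √(Real.pi / 2) := by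
      rw [show Real.pi / (1 / 2) = 2 ^ 2 * (Real.pi / 2) by ring, Real.sqrt_mul (by norm_num),
        Real.sqrt_sq (by norm_num)]
    rw [h2, mul_div_cancel_left₀ _ two_ne_zero] at h
    simp only [gaussianMoment, mul_zero, pow_zero, one_mul, ascPochhammer_zero,
      Polynomial.eval_one, mul_one, ← h]
    congr 1 with u
    ring_nf
  | succ j ih =>
    rw [mul_add, mul_one, gaussianMoment_add_two, ih, ascPochhammer_succ_eval]
    push_cast
    ring

theorem integrableOn_pow_mul_gaussian_half (p : ℕ) :
    IntegrableOn (fun u : ℝ => u ^ p * Real.exp (-u ^ 2 / 2)) (Set.Ioi 0) := by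
  refine ((integrable_pow_mul_gaussian p (b := 1 / 2) (by norm_num)).congr
    (Eventually.of_forall fun x => ?_)).integrableOn
  ring_nf

/-- Termwise integration of a power series against the Gaussian on the half-line. -/
theorem hasSum_mul_gaussianMoment {a : ℕ → ℝ} {p : ℕ → ℕ} {f : ℝ → ℝ}
    (hs : Summable fun j => |a j| * gaussianMoment (p j))
    (hf : ∀ u ∈ Set.Ioi (0 : ℝ), HasSum (fun j => a j * u ^ p j) (f u)) :
    HasSum (fun j => a j * gaussianMoment (p j))
      (∫ u in Set.Ioi (0 : ℝ), f u * Real.exp (-u ^ 2 / 2)) := by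
  have h := hasSum_integral_of_summable_integral_norm (μ := volume.restrict (Set.Ioi (0 : ℝ)))
    (F := fun j u => a j * (u ^ p j * Real.exp (-u ^ 2 / 2)))
    (fun j => (integrableOn_pow_mul_gaussian_half (p j)).const_mul (a j)) ?_
  · simp_rw [integral_const_mul] at h
    convert! h using 1
    refine setIntegral_congr_fun measurableSet_Ioi fun u hu => ?_
    simp only [← mul_assoc]
    exact ((hf u hu).mul_right _).tsum_eq.symm
  · refine hs.congr fun j => ?_
    rw [gaussianMoment, ← integral_const_mul]
    refine setIntegral_congr_fun measurableSet_Ioi fun u hu => ?_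
    have hu' : (0 : ℝ) ≤ u := (Set.mem_Ioi.1 hu).le
    simp only [norm_mul, Real.norm_eq_abs]
    rw [abs_of_nonneg (show 0 ≤ u ^ p j by positivity), abs_of_nonneg (Real.exp_nonneg _)]

/-- Termwise integration when the result is a confluent hypergeometric series. -/
theorem integral_mul_gaussian_eq_confluentPhi {α : ℕ → ℝ} {p : ℕ → ℕ} {f : ℝ → ℝ} {C a c z : ℝ}
    (hf : ∀ u ∈ Set.Ioi (0 : ℝ), HasSum (fun j => α j * u ^ p j) (f u))
    (hα : ∀ j, α j * gaussianMoment (p j) = C * confluentTerm a c z j) :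
    ∫ u in Set.Ioi (0 : ℝ), f u * Real.exp (-u ^ 2 / 2) = C * confluentPhi a c z := by
  have hm : ∀ p, 0 ≤ gaussianMoment p := fun p =>
    setIntegral_nonneg measurableSet_Ioi fun u hu =>
      mul_nonneg (pow_nonneg (Set.mem_Ioi.1 hu).le _) (Real.exp_nonneg _)
  refine (hasSum_mul_gaussianMoment ?_ hf).unique ?_
  · refine ((summable_norm_confluentTerm a c z).mul_left |C|).congr fun j => ?_
    rw [Real.norm_eq_abs, ← abs_mul, ← hα, abs_mul, abs_of_nonneg (hm _)]
  · simp_rw [hα]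
    exact (summable_confluentTerm a c z).hasSum.mul_left C

/-- In the sinh series, the even Gaussian moments supply (1/2)_j and the factorials (2j+1)! supply
(3/2)_j j!. -/
theorem integral_sinh_div_mul_gaussian (x : ℝ) :
    ∫ u in Set.Ioi (0 : ℝ), Real.sinh (x * u) / u * Real.exp (-u ^ 2 / 2) =
      √(Real.pi / 2) * x * confluentPhi (1 / 2) (3 / 2) (x ^ 2 / 2) := by
  refine integral_mul_gaussian_eq_confluentPhi (p := fun j => 2 * j)
    (α := fun j => x ^ (2 * j + 1) / ((2 * j + 1).factorial : ℝ)) (fun u hu => ?_) fun j => ?_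
  · have hu0 : u ≠ 0 := (Set.mem_Ioi.1 hu).ne'
    convert! (Real.hasSum_sinh (x * u)).div_const u using 2 with j
    rw [mul_pow, pow_succ u]
    field_simp
  · have h := ascPochhammer_eval_three_halves j
    have h3 := (ascPochhammer_eval_pos (show (0 : ℝ) < 3 / 2 by norm_num) j).ne'
    rw [gaussianMoment_even, confluentTerm, ← h]
    have h2 : (j.factorial : ℝ) ≠ 0 := by positivity
    rw [show (4 : ℝ) ^ j = 2 ^ j * 2 ^ j by rw [← mul_pow]; norm_num, div_pow, ← pow_mul, pow_succ]
    field_simp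

/-- The odd Gaussian moments contain (k + j)! = k! (k+1)_j, so termwise integration gives Φ(k+1,
3/2; -x²/2). Kummer's transformation then extracts exp(-x²/2). -/
theorem integral_pow_mul_sin_mul_gaussian (k : ℕ) (x : ℝ) :
    ∫ u in Set.Ioi (0 : ℝ), u ^ (2 * k) * Real.sin (x * u) * Real.exp (-u ^ 2 / 2) =
      2 ^ k * k.factorial * x *
        (Real.exp (-x ^ 2 / 2) * confluentPhi (1 / 2 - k) (3 / 2) (x ^ 2 / 2)) := by
  have hk := confluentPhi_kummer ((k : ℝ) + 1) (show (0 : ℝ) < 3 / 2 by norm_num) (-x ^ 2 / 2)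
  rw [show (3 / 2 : ℝ) - (k + 1) = 1 / 2 - k by ring, show -(-x ^ 2 / 2) = x ^ 2 / 2 by ring] at hk
  rw [hk]
  refine integral_mul_gaussian_eq_confluentPhi (p := fun j => 2 * (k + j) + 1)
    (α := fun j => (-1) ^ j * x ^ (2 * j + 1) / ((2 * j + 1).factorial : ℝ))
    (fun u hu => ?_) fun j => ?_
  · convert! (Real.hasSum_sin (x * u)).mul_left (u ^ (2 * k)) using 2 with j
    rw [mul_pow]
    ring
  · have h := ascPochhammer_eval_three_halves j
    have h' := ascPochhammer_eval_natCast_add_one k j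
    have h3 := (ascPochhammer_eval_pos (show (0 : ℝ) < 3 / 2 by norm_num) j).ne'
    rw [gaussianMoment_odd, confluentTerm, ← h, ← h']
    have h2 : (j.factorial : ℝ) ≠ 0 := by positivity
    rw [show (4 : ℝ) ^ j = 2 ^ j * 2 ^ j by rw [← mul_pow]; norm_num, div_pow, neg_pow (x ^ 2),
      ← pow_mul, pow_succ]
    field_simp
    ring

theorem integral_pow_mul_cos_mul_gaussian (k : ℕ) (x : ℝ) :
    ∫ u in Set.Ioi (0 : ℝ), u ^ (2 * k + 1) * Real.cos (x * u) * Real.exp (-u ^ 2 / 2) =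
      2 ^ k * k.factorial *
        (Real.exp (-x ^ 2 / 2) * confluentPhi (-1 / 2 - k) (1 / 2) (x ^ 2 / 2)) := by
  have hk := confluentPhi_kummer ((k : ℝ) + 1) (show (0 : ℝ) < 1 / 2 by norm_num) (-x ^ 2 / 2)
  rw [show (1 / 2 : ℝ) - (k + 1) = -1 / 2 - k by ring,
    show -(-x ^ 2 / 2) = x ^ 2 / 2 by ring] at hk
  rw [hk]
  refine integral_mul_gaussian_eq_confluentPhi (p := fun j => 2 * (k + j) + 1)
    (α := fun j => (-1) ^ j * x ^ (2 * j) / ((2 * j).factorial : ℝ))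
    (fun u hu => ?_) fun j => ?_
  · convert! (Real.hasSum_cos (x * u)).mul_left (u ^ (2 * k + 1)) using 2 with j
    rw [mul_pow]
    ring
  · have h := ascPochhammer_eval_half j
    have h' := ascPochhammer_eval_natCast_add_one k j
    have h3 := (ascPochhammer_eval_pos (show (0 : ℝ) < 1 / 2 by norm_num) j).ne'
    rw [gaussianMoment_odd, confluentTerm, ← h, ← h']
    have h2 : (j.factorial : ℝ) ≠ 0 := by positivity
    rw [show (4 : ℝ) ^ j = 2 ^ j * 2 ^ j by rw [← mul_pow]; norm_num, div_pow, neg_pow (x ^ 2),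
      ← pow_mul]
    field_simp
    ring

/-! ### Principal values and multiplication by the variable. -/

section HilbertTransform

theorem measurableSet_lt_abs_sub (x ε : ℝ) : MeasurableSet {t : ℝ | ε < |t - x|} :=
  measurableSet_lt measurable_const (by fun_prop)

theorem integrableOn_div_sub {φ : ℝ → ℝ} (hφ : Integrable φ) (x : ℝ) {ε : ℝ} (hε : 0 < ε) :
    IntegrableOn (fun t => φ t / (t - x)) {t | ε < |t - x|} := by
  have hm : AEStronglyMeasurable (fun t : ℝ => (t - x)⁻¹)
      (volume.restrict {t | ε < |t - x|}) := by
    apply Measurable.aestronglyMeasurable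
    fun_prop
  have h := (hφ.integrableOn (s := {t | ε < |t - x|})).bdd_mul (c := ε⁻¹) hm ?_
  · exact h.congr (Eventually.of_forall fun t => by simp only [div_eq_mul_inv]; ring)
  · refine (ae_restrict_iff' (measurableSet_lt_abs_sub x ε)).2 (Eventually.of_forall fun t ht => ?_)
    rw [norm_inv, Real.norm_eq_abs]
    exact inv_anti₀ hε (le_of_lt ht)

/-- The substitutions t = x + s and t = x - s fold the two outer rays onto one; the odd kernel turns
the sum into a symmetric difference. -/
theorem setIntegral_div_sub_eq {φ : ℝ → ℝ} (hφ : Integrable φ) (x : ℝ) {ε : ℝ} (hε : 0 < ε) :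
    ∫ t in {t | ε < |t - x|}, φ t / (t - x) =
      ∫ s in Set.Ioi ε, (φ (x + s) - φ (x - s)) / s := by
  set F : ℝ → ℝ := fun t => φ t / (t - x) with hF
  have hset : {t : ℝ | ε < |t - x|} = Set.Iio (x - ε) ∪ Set.Ioi (x + ε) := by
    ext t
    simp only [Set.mem_ofPred_eq, Set.mem_union, Set.mem_Iio, Set.mem_Ioi, lt_abs]
    constructor
    · rintro (h | h)
      · right; linarith
      · left; linarith
    · rintro (h | h)
      · right; linarith
      · left; linarith
  have hint := integrableOn_div_sub hφ x hε
  rw [hset] at hint ⊢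
  have h1 : IntegrableOn F (Set.Iio (x - ε)) := hint.mono_set Set.subset_union_left
  have h2 : IntegrableOn F (Set.Ioi (x + ε)) := hint.mono_set Set.subset_union_right
  have hdisj : Disjoint (Set.Iio (x - ε)) (Set.Ioi (x + ε)) := by
    rw [Set.disjoint_left]
    intro t ht ht'
    have := Set.mem_Iio.1 ht
    have := Set.mem_Ioi.1 ht'
    linarith
  have e1 : (MeasurableEquiv.addLeft x) ⁻¹' Set.Ioi (x + ε) = Set.Ioi ε := by
    ext s; simp
  have e2 : (MeasurableEquiv.subLeft x) ⁻¹' Set.Iio (x - ε) = Set.Ioi ε := by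
    ext s; exact sub_lt_sub_iff_left x
  have m1 : MeasurePreserving (MeasurableEquiv.addLeft x) := measurePreserving_add_left volume x
  have m2 : MeasurePreserving (MeasurableEquiv.subLeft x) := Measure.measurePreserving_sub_left volume x
  have i1 : IntegrableOn (fun s => F (x + s)) (Set.Ioi ε) := by
    rw [← e1]
    exact (m1.integrableOn_comp_preimage (MeasurableEquiv.measurableEmbedding _)).2 h2
  have i2 : IntegrableOn (fun s => F (x - s)) (Set.Ioi ε) := by
    rw [← e2]
    exact (m2.integrableOn_comp_preimage (MeasurableEquiv.measurableEmbedding _)).2 h1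
  have j1 : ∫ s in Set.Ioi ε, F (x + s) = ∫ t in Set.Ioi (x + ε), F t := by
    rw [← e1]
    exact m1.setIntegral_preimage_emb (MeasurableEquiv.measurableEmbedding _) _ _
  have j2 : ∫ s in Set.Ioi ε, F (x - s) = ∫ t in Set.Iio (x - ε), F t := by
    rw [← e2]
    exact m2.setIntegral_preimage_emb (MeasurableEquiv.measurableEmbedding _) _ _
  rw [setIntegral_union hdisj measurableSet_Ioi h1 h2, ← j1, ← j2, ← integral_add i2 i1]
  refine integral_congr_ae (Eventually.of_forall fun s => ?_)
  simp only [hF, add_sub_cancel_left, sub_sub_cancel_left, div_neg]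
  ring

theorem tendsto_setIntegral_Ioi_nhdsGT {g : ℝ → ℝ} {a : ℝ} (hg : IntegrableOn g (Set.Ioi a)) :
    Tendsto (fun ε => ∫ s in Set.Ioi ε, g s) (𝓝[>] a) (𝓝 (∫ s in Set.Ioi a, g s)) := by
  have h : Tendsto (fun ε => ∫ s in Set.Ioi a, (Set.Ioi ε).indicator g s) (𝓝[>] a)
      (𝓝 (∫ s in Set.Ioi a, g s)) := by
    refine tendsto_integral_filter_of_dominated_convergence (fun s => ‖g s‖)
      (Eventually.of_forall fun ε => hg.aestronglyMeasurable.indicator measurableSet_Ioi)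
      (Eventually.of_forall fun ε => Eventually.of_forall fun s =>
        norm_indicator_le_norm_self _ _) hg.norm ?_
    refine (ae_restrict_iff' measurableSet_Ioi).2 (Eventually.of_forall fun s hs => ?_)
    refine tendsto_const_nhds.congr' ?_
    filter_upwards [Ioo_mem_nhdsGT (Set.mem_Ioi.1 hs)] with ε hε
    rw [Set.indicator_of_mem (Set.mem_Ioi.2 hε.2)]
  refine h.congr' ?_
  filter_upwards [self_mem_nhdsWithin] with ε hε
  rw [setIntegral_indicator measurableSet_Ioi, Set.inter_eq_right.2]
  exact Set.Ioi_subset_Ioi (Set.mem_Ioi.1 hε).le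

/-- The Hilbert transform as an absolutely convergent integral of symmetric differences. -/
theorem hasHilbertTransformAt_of_integrableOn {φ : ℝ → ℝ} (hφ : Integrable φ) {x : ℝ}
    (h : IntegrableOn (fun s => (φ (x + s) - φ (x - s)) / s) (Set.Ioi 0)) :
    HasHilbertTransformAt φ x
      (1 / Real.pi * ∫ s in Set.Ioi 0, (φ (x + s) - φ (x - s)) / s) := by
  refine ⟨fun ε hε => integrableOn_div_sub hφ x hε, ?_⟩
  refine ((tendsto_setIntegral_Ioi_nhdsGT h).const_mul _).congr' ?_
  filter_upwards [self_mem_nhdsWithin] with ε hε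
  rw [setIntegral_div_sub_eq hφ x hε]

theorem HasHilbertTransformAt.linear_comb {φ ψ : ℝ → ℝ} {x g h : ℝ}
    (hφ : HasHilbertTransformAt φ x g) (hψ : HasHilbertTransformAt ψ x h) (a b : ℝ) :
    HasHilbertTransformAt (fun t => a * φ t + b * ψ t) x (a * g + b * h) := by
  have he : ∀ t, (a * φ t + b * ψ t) / (t - x) = a * (φ t / (t - x)) + b * (ψ t / (t - x)) :=
    fun t => by ring
  constructor
  · intro ε hε
    simp_rw [he]
    exact ((hφ.1 ε hε).const_mul a).add ((hψ.1 ε hε).const_mul b)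
  · refine ((hφ.2.const_mul a).add (hψ.2.const_mul b)).congr' ?_
    filter_upwards [self_mem_nhdsWithin] with ε hε
    simp_rw [he]
    rw [integral_add ((hφ.1 ε hε).const_mul a) ((hψ.1 ε hε).const_mul b), integral_const_mul,
      integral_const_mul]
    ring

/-- Multiplication by the variable commutes with the Hilbert transform up to the total mass. -/
theorem HasHilbertTransformAt.id_mul {φ : ℝ → ℝ} (hi : Integrable φ) {x g : ℝ}
    (hφ : HasHilbertTransformAt φ x g) :
    HasHilbertTransformAt (fun t => t * φ t) x (x * g + 1 / Real.pi * ∫ t, φ t) := by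
  -- Here t / (t - x) = x / (t - x) + 1. The last term has no singularity and contributes the total
  -- mass as ε → 0.
  have he : ∀ ε, 0 < ε → Set.EqOn (fun t => t * φ t / (t - x))
      (fun t => x * (φ t / (t - x)) + φ t) {t | ε < |t - x|} := fun ε hε t ht => by
    have h0 : t - x ≠ 0 := abs_pos.1 (hε.trans ht)
    simp only
    field_simp
    ring
  constructor
  · intro ε hε
    exact IntegrableOn.congr_fun (((hφ.1 ε hε).const_mul x).add hi.integrableOn) (he ε hε).symm
      (measurableSet_lt_abs_sub x ε)
  · have hlim : Tendsto (fun ε : ℝ => ∫ t in {t | ε < |t - x|}, φ t) (𝓝[>] 0) (𝓝 (∫ t, φ t)) := by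
      have h : Tendsto (fun ε : ℝ => ∫ t, ({t | ε < |t - x|} : Set ℝ).indicator φ t) (𝓝[>] 0)
          (𝓝 (∫ t, φ t)) := by
        refine tendsto_integral_filter_of_dominated_convergence (fun s => ‖φ s‖)
          (Eventually.of_forall fun ε =>
            hi.aestronglyMeasurable.indicator (measurableSet_lt_abs_sub x ε))
          (Eventually.of_forall fun ε => Eventually.of_forall fun s =>
            norm_indicator_le_norm_self _ _) hi.norm ?_
        have hne : ∀ᵐ t : ℝ, t ≠ x := by simp [ae_iff, measure_singleton]
        filter_upwards [hne] with t ht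
        refine tendsto_const_nhds.congr' ?_
        filter_upwards [Ioo_mem_nhdsGT (abs_pos.2 (sub_ne_zero.2 ht))] with ε hε
        rw [Set.indicator_of_mem (show t ∈ {t | ε < |t - x|} from hε.2)]
      refine h.congr fun ε => integral_indicator (measurableSet_lt_abs_sub x ε)
    refine ((hφ.2.const_mul x).add (hlim.const_mul (1 / Real.pi))).congr' ?_
    filter_upwards [self_mem_nhdsWithin] with ε hε
    rw [setIntegral_congr_fun (measurableSet_lt_abs_sub x ε) (he ε hε),
      integral_add ((hφ.1 ε hε).const_mul x) hi.integrableOn, integral_const_mul]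
    ring

end HilbertTransform

/-! ### The half-line Fourier integral represents the Hilbert transform. -/

/-- The Fourier integral of a Hermite function over the positive half-line. -/
noncomputable def hermiteHalfFourier (n : ℕ) (x : ℝ) : ℂ :=
  ∫ u in Set.Ioi (0 : ℝ), (hermiteFun n u : ℂ) * Complex.exp (Complex.I * (x * u))

theorem integrable_mul_cexp_I {φ : ℝ → ℝ} (hφ : Integrable φ) (x : ℝ) :
    Integrable fun u : ℝ => (φ u : ℂ) * Complex.exp (Complex.I * (x * u)) := by
  refine hφ.ofReal.mul_bdd (c := 1) (by fun_prop) (Eventually.of_forall fun u => ?_)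
  rw [← Complex.ofReal_mul, mul_comm, Complex.norm_exp_ofReal_mul_I]

/-- Integration by parts. Only the boundary value at 0 survives: the product and its derivative are
integrable, so the product tends to 0 at infinity. -/
theorem integral_Ioi_deriv_mul_cexp {φ φ' : ℝ → ℝ} (hd : ∀ u, HasDerivAt φ (φ' u) u)
    (hi : Integrable φ) (hi' : Integrable φ') (x : ℝ) :
    ∫ u in Set.Ioi (0 : ℝ), (φ' u : ℂ) * Complex.exp (Complex.I * (x * u)) =
      -(φ 0 : ℂ) - Complex.I * x *
        ∫ u in Set.Ioi (0 : ℝ), (φ u : ℂ) * Complex.exp (Complex.I * (x * u)) := by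
  have h1 := (integrable_mul_cexp_I hi x).integrableOn (s := Set.Ioi 0)
  have h2 := (integrable_mul_cexp_I hi' x).integrableOn (s := Set.Ioi 0)
  have hder : ∀ u : ℝ, HasDerivAt (fun u : ℝ => (φ u : ℂ) * Complex.exp (Complex.I * (x * u)))
      ((φ' u : ℂ) * Complex.exp (Complex.I * (x * u)) +
        Complex.I * x * ((φ u : ℂ) * Complex.exp (Complex.I * (x * u)))) u := fun u => by
    have he : HasDerivAt (fun u : ℝ => Complex.I * ((x : ℂ) * (u : ℂ))) (Complex.I * (x * 1)) u :=
      ((hasDerivAt_id u).ofReal_comp.const_mul (x : ℂ)).const_mul Complex.I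
    exact ((hd u).ofReal_comp.mul he.cexp).congr_deriv (by ring)
  have hint := h2.add (h1.const_mul (Complex.I * x))
  have ht := tendsto_zero_of_hasDerivAt_of_integrableOn_Ioi (fun u _ => hder u) hint h1
  have h := integral_Ioi_of_hasDerivAt_of_tendsto' (fun u _ => hder u) hint ht
  rw [integral_add h2 (h1.const_mul _), integral_const_mul] at h
  simp only [Complex.ofReal_zero, mul_zero, Complex.exp_zero, mul_one, zero_sub] at h
  rw [← h]; ring

theorem integrable_deriv_hermiteFun (n : ℕ) :
    Integrable fun u => u * hermiteFun n u - hermiteFun (n + 1) u := by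
  have h := integrable_pow_mul_hermiteFun n 1
  simp only [pow_one] at h
  exact h.sub (integrable_hermiteFun (n + 1))

theorem hermiteHalfFourier_one (x : ℝ) :
    hermiteHalfFourier 1 x = 2 * hermiteFun 0 0 + 2 * Complex.I * x * hermiteHalfFourier 0 x := by
  have h := integral_Ioi_deriv_mul_cexp (hasDerivAt_hermiteFun 0) (integrable_hermiteFun 0)
    (integrable_deriv_hermiteFun 0) x
  have e : ∀ u : ℝ, (hermiteFun 1 u : ℂ) * Complex.exp (Complex.I * (x * u)) =
      (-2) * (((u * hermiteFun 0 u - hermiteFun (0 + 1) u : ℝ) : ℂ) *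
        Complex.exp (Complex.I * (x * u))) := fun u => by
    rw [zero_add, hermiteFun_one]; push_cast; ring
  rw [hermiteHalfFourier]
  simp_rw [e]
  rw [integral_const_mul, h, hermiteHalfFourier]
  ring

/-- Integrates h_{n+2} = 2(n+1) h_n - 2 h_{n+1}' by parts. -/
theorem hermiteHalfFourier_add_two (n : ℕ) (x : ℝ) :
    hermiteHalfFourier (n + 2) x = 2 * (n + 1) * hermiteHalfFourier n x +
      2 * hermiteFun (n + 1) 0 + 2 * Complex.I * x * hermiteHalfFourier (n + 1) x := by
  have h := integral_Ioi_deriv_mul_cexp (hasDerivAt_hermiteFun (n + 1))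
    (integrable_hermiteFun (n + 1)) (integrable_deriv_hermiteFun (n + 1)) x
  have e : ∀ u : ℝ, (hermiteFun (n + 2) u : ℂ) * Complex.exp (Complex.I * (x * u)) =
      2 * (n + 1) * ((hermiteFun n u : ℂ) * Complex.exp (Complex.I * (x * u))) +
      (-2) * (((u * hermiteFun (n + 1) u - hermiteFun (n + 1 + 1) u : ℝ) : ℂ) *
        Complex.exp (Complex.I * (x * u))) := fun u => by
    rw [hermiteFun_add_two]; push_cast; ring
  rw [hermiteHalfFourier]
  simp_rw [e]
  rw [integral_add ((integrable_mul_cexp_I (integrable_hermiteFun n) x).integrableOn.const_mul _)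
    ((integrable_mul_cexp_I (integrable_deriv_hermiteFun (n + 1)) x).integrableOn.const_mul _),
    integral_const_mul, integral_const_mul, h, hermiteHalfFourier, hermiteHalfFourier]
  ring

theorem re_hermiteHalfFourier (n : ℕ) (x : ℝ) :
    (hermiteHalfFourier n x).re = ∫ u in Set.Ioi (0 : ℝ), hermiteFun n u * Real.cos (x * u) := by
  have h := integral_re ((integrable_mul_cexp_I (integrable_hermiteFun n) x).integrableOn
    (s := Set.Ioi 0))
  rw [hermiteHalfFourier]
  refine Eq.trans h.symm (integral_congr_ae (Eventually.of_forall fun u => ?_))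
  simp only [RCLike.re_to_complex, Complex.re_ofReal_mul]
  rw [← Complex.ofReal_mul, mul_comm Complex.I, Complex.exp_ofReal_mul_I_re]

theorem im_hermiteHalfFourier (n : ℕ) (x : ℝ) :
    (hermiteHalfFourier n x).im = ∫ u in Set.Ioi (0 : ℝ), hermiteFun n u * Real.sin (x * u) := by
  have h := integral_im ((integrable_mul_cexp_I (integrable_hermiteFun n) x).integrableOn
    (s := Set.Ioi 0))
  rw [hermiteHalfFourier]
  refine Eq.trans h.symm (integral_congr_ae (Eventually.of_forall fun u => ?_))
  simp only [RCLike.im_to_complex, Complex.im_ofReal_mul]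
  rw [← Complex.ofReal_mul, mul_comm Complex.I, Complex.exp_ofReal_mul_I_im]

/-- The Fourier representation of the Hilbert transform of the `n`-th Hermite function. -/
noncomputable def hermiteHilbert (n : ℕ) (x : ℝ) : ℝ :=
  √(2 / Real.pi) * ((-Complex.I) ^ n * Complex.I * hermiteHalfFourier n x).re

theorem sqrt_two_div_pi_eq : √(2 / Real.pi) = 1 / Real.pi * √(2 * Real.pi) := by
  rw [show 2 / Real.pi = (1 / Real.pi) ^ 2 * (2 * Real.pi) by
    field_simp, Real.sqrt_mul (by positivity), Real.sqrt_sq (by positivity)]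

theorem hermiteHilbert_one (x : ℝ) :
    hermiteHilbert 1 x = 2 * (x * hermiteHilbert 0 x + 1 / Real.pi * ∫ t, hermiteFun 0 t) := by
  rw [integral_hermiteFun, hermiteHilbert, hermiteHilbert, hermiteHalfFourier_one,
    sqrt_two_div_pi_eq]
  simp
  ring

/-- This has the shape produced by `HasHilbertTransformAt.id_mul`: the boundary term h_{n+1}(0),
with its phase, is the total mass of h_{n+1} by `integral_hermiteFun`. -/
theorem hermiteHilbert_add_two (n : ℕ) (x : ℝ) :
    hermiteHilbert (n + 2) x =
      2 * (x * hermiteHilbert (n + 1) x + 1 / Real.pi * ∫ t, hermiteFun (n + 1) t) +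
        (-(2 * (n + 1))) * hermiteHilbert n x := by
  have e : (-Complex.I) ^ (n + 2) * Complex.I * hermiteHalfFourier (n + 2) x =
      ((2 * x : ℝ) : ℂ) * ((-Complex.I) ^ (n + 1) * Complex.I * hermiteHalfFourier (n + 1) x) +
      ((2 * hermiteFun (n + 1) 0 : ℝ) : ℂ) * (-Complex.I) ^ (n + 1) +
      ((-(2 * (n + 1)) : ℝ) : ℂ) * ((-Complex.I) ^ n * Complex.I * hermiteHalfFourier n x) := by
    rw [hermiteHalfFourier_add_two, pow_add _ n 2, pow_succ _ n]
    push_cast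
    generalize (-Complex.I) ^ n = z
    linear_combination (2 * (n + 1) * z * Complex.I * hermiteHalfFourier n x +
      2 * hermiteFun (n + 1) 0 * z * Complex.I +
      2 * Complex.I ^ 2 * x * z * hermiteHalfFourier (n + 1) x) * Complex.I_sq
  rw [integral_hermiteFun, hermiteHilbert, e, hermiteHilbert, hermiteHilbert]
  simp only [Complex.add_re, Complex.re_ofReal_mul]
  rw [sqrt_two_div_pi_eq]
  ring

/-- Both integrals are multiples of x Φ(1/2, 3/2; x²/2), so the base case needs no contour shift. -/
theorem integral_sinh_mul_gaussian_eq (x : ℝ) :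
    ∫ u in Set.Ioi (0 : ℝ), Real.sinh (x * u) / u * Real.exp (-u ^ 2 / 2) =
      √(Real.pi / 2) * Real.exp (x ^ 2 / 2) *
        ∫ u in Set.Ioi (0 : ℝ), hermiteFun 0 u * Real.sin (x * u) := by
  have h := integral_pow_mul_sin_mul_gaussian 0 x
  rw [integral_sinh_div_mul_gaussian]
  simp only [mul_zero, pow_zero, one_mul, Nat.factorial_zero, Nat.cast_one, Nat.cast_zero,
    sub_zero] at h
  simp_rw [hermiteFun_zero, mul_comm (Real.exp _) (Real.sin _)]
  rw [h, show Real.exp (-x ^ 2 / 2) = (Real.exp (x ^ 2 / 2))⁻¹ by rw [← Real.exp_neg, neg_div]]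
  have := Real.exp_ne_zero (x ^ 2 / 2)
  field_simp

theorem integrableOn_sinh_div_mul_gaussian (x : ℝ) :
    IntegrableOn (fun u : ℝ => Real.sinh (x * u) / u * Real.exp (-u ^ 2 / 2)) (Set.Ioi 0) := by
  by_cases hx : x = 0
  · simp [hx]
  -- A non-integrable function has Bochner integral 0 by convention, so a nonzero value proves
  -- integrability. The confluent series is positive because its parameters are.
  · refine Integrable.of_integral_ne_zero ?_
    rw [integral_sinh_div_mul_gaussian]
    have hpos : 0 < confluentPhi (1 / 2) (3 / 2) (x ^ 2 / 2) := by
      refine (summable_confluentTerm _ _ _).tsum_pos (fun k => ?_) 0 (by simp [confluentTerm])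
      have h1 := ascPochhammer_eval_pos (show (0 : ℝ) < 1 / 2 by norm_num) k
      have h2 := ascPochhammer_eval_pos (show (0 : ℝ) < 3 / 2 by norm_num) k
      rw [confluentTerm]
      positivity
    exact mul_ne_zero (mul_ne_zero (by positivity) hx) hpos.ne'

theorem hasHilbertTransformAt_hermiteFun_zero (x : ℝ) :
    HasHilbertTransformAt (hermiteFun 0) x (hermiteHilbert 0 x) := by
  have e : ∀ s, (hermiteFun 0 (x + s) - hermiteFun 0 (x - s)) / s =
      (-2 * Real.exp (-x ^ 2 / 2)) * (Real.sinh (x * s) / s * Real.exp (-s ^ 2 / 2)) := fun s => by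
    rw [hermiteFun_zero, hermiteFun_zero, Real.sinh_eq,
      show -(x + s) ^ 2 / 2 = -x ^ 2 / 2 + -s ^ 2 / 2 + -(x * s) by ring,
      show -(x - s) ^ 2 / 2 = -x ^ 2 / 2 + -s ^ 2 / 2 + x * s by ring, Real.exp_add _ (-(x * s)),
      Real.exp_add _ (x * s), Real.exp_add]
    ring
  have hi : IntegrableOn (fun s => (hermiteFun 0 (x + s) - hermiteFun 0 (x - s)) / s)
      (Set.Ioi 0) := by
    simp_rw [e]
    exact (integrableOn_sinh_div_mul_gaussian x).const_mul _
  convert! hasHilbertTransformAt_of_integrableOn (integrable_hermiteFun 0) hi using 1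
  simp_rw [e]
  rw [integral_const_mul, integral_sinh_mul_gaussian_eq, ← im_hermiteHalfFourier, hermiteHilbert,
    show Real.exp (-x ^ 2 / 2) = (Real.exp (x ^ 2 / 2))⁻¹ by rw [← Real.exp_neg, neg_div]]
  have := Real.exp_ne_zero (x ^ 2 / 2)
  have h2 : √(2 / Real.pi) = 1 / Real.pi * 2 * √(Real.pi / 2) := by
    rw [show 2 / Real.pi = (1 / Real.pi * 2) ^ 2 * (Real.pi / 2) by field_simp,
      Real.sqrt_mul (by positivity), Real.sqrt_sq (by positivity)]
  rw [h2]
  simp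
  field_simp

theorem hasHilbertTransformAt_hermiteFun (n : ℕ) (x : ℝ) :
    HasHilbertTransformAt (hermiteFun n) x (hermiteHilbert n x) := by
  induction n using Nat.twoStepInduction with
  | zero => exact hasHilbertTransformAt_hermiteFun_zero x
  | one =>
    have h0 := (hasHilbertTransformAt_hermiteFun_zero x).id_mul (integrable_hermiteFun 0)
    -- The second summand is a dummy with coefficient 0; only scaling by 2 is needed.
    have h := h0.linear_comb h0 2 0
    rw [zero_mul, add_zero, ← hermiteHilbert_one] at h
    convert! h using 1
    funext t
    rw [hermiteFun_one]; ring
  | more n ih1 ih2 =>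
    have h := (ih2.id_mul (integrable_hermiteFun (n + 1))).linear_comb ih1 2 (-(2 * (n + 1)))
    rw [← hermiteHilbert_add_two] at h
    convert! h using 1
    funext t
    rw [hermiteFun_add_two]; ring

theorem hermiteG_eq (n : ℕ) : hermiteG n = hermiteHilbert n :=
  funext fun x => (hasHilbertTransformAt_hermiteFun n x).hilbertTransform_eq

/-! ### Power expansion of H_n and the confluent formulas. -/

section ExplicitFormulas

theorem doubleFactorial_two_mul_sub_one_mul (n : ℕ) :
    (2 * n - 1).doubleFactorial * (2 ^ n * n.factorial) = (2 * n).factorial := by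
  cases n with
  | zero => simp
  | succ n =>
    rw [← Nat.doubleFactorial_two_mul, show 2 * (n + 1) - 1 = 2 * n + 1 by omega,
      show 2 * (n + 1) = 2 * n + 1 + 1 by ring, Nat.factorial_eq_mul_doubleFactorial, mul_comm]

theorem coeff_hermite_eq_div (n k : ℕ) :
    ((Polynomial.hermite (2 * n + k)).coeff k : ℝ) =
      (-1) ^ n * ((2 * n + k).factorial : ℝ) / (2 ^ n * n.factorial * k.factorial) := by
  have h : (((2 * n - 1).doubleFactorial : ℕ) : ℝ) * (2 ^ n * n.factorial) =
      ((2 * n).factorial : ℝ) := by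
    exact_mod_cast doubleFactorial_two_mul_sub_one_mul n
  have h1 : ((2 * n).factorial : ℝ) ≠ 0 := by positivity
  have h2 : (n.factorial : ℝ) ≠ 0 := by positivity
  have h3 : (k.factorial : ℝ) ≠ 0 := by positivity
  rw [Polynomial.coeff_hermite_explicit]
  push_cast
  rw [Nat.cast_choose ℝ (Nat.le_add_left k (2 * n)), Nat.add_sub_cancel, ← h]
  rw [← h] at h1
  have h4 : ((2 * n - 1).doubleFactorial : ℝ) ≠ 0 := left_ne_zero_of_mul h1
  field_simp

theorem hermiteH_term (n k : ℕ) (x : ℝ) :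
    √2 ^ (2 * n + k) * (((Polynomial.hermite (2 * n + k)).coeff k : ℝ) * (√2 * x) ^ k) =
      (-1) ^ n * ((2 * n + k).factorial : ℝ) * 2 ^ k / (n.factorial * k.factorial) * x ^ k := by
  have h2 : (√2 : ℝ) ^ 2 = 2 := Real.sq_sqrt (by norm_num)
  have h3 : √2 ^ k * √2 ^ k = (2 : ℝ) ^ k := by rw [← mul_pow, ← sq, h2]
  rw [coeff_hermite_eq_div, pow_add, pow_mul, h2, mul_pow, ← h3]
  field_simp

theorem sum_range_even {g : ℕ → ℝ} (hg : ∀ k, g (2 * k + 1) = 0) (m : ℕ) :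
    ∑ i ∈ Finset.range (2 * m + 1), g i = ∑ k ∈ Finset.range (m + 1), g (2 * k) := by
  induction m with
  | zero => simp
  | succ m ih =>
    rw [show 2 * (m + 1) + 1 = 2 * m + 1 + 1 + 1 by ring, Finset.sum_range_succ,
      Finset.sum_range_succ, ih, hg, Finset.sum_range_succ _ (m + 1)]
    ring_nf

theorem sum_range_odd {g : ℕ → ℝ} (hg : ∀ k, g (2 * k) = 0) (m : ℕ) :
    ∑ i ∈ Finset.range (2 * m + 1 + 1), g i = ∑ k ∈ Finset.range (m + 1), g (2 * k + 1) := by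
  induction m with
  | zero => simpa [Finset.sum_range_succ] using hg 0
  | succ m ih =>
    rw [show 2 * (m + 1) + 1 + 1 = 2 * m + 1 + 1 + 1 + 1 by ring, Finset.sum_range_succ,
      Finset.sum_range_succ, ih, show 2 * m + 1 + 1 = 2 * (m + 1) by ring, hg,
      Finset.sum_range_succ _ (m + 1), add_zero]
    ring_nf

theorem hermiteH_eq_sum_range (n : ℕ) (x : ℝ) :
    hermiteH n x = ∑ i ∈ Finset.range (n + 1),
      √2 ^ n * (((Polynomial.hermite n).coeff i : ℝ) * (√2 * x) ^ i) := by
  rw [hermiteH, Polynomial.aeval_eq_sum_range, Polynomial.natDegree_hermite, Finset.mul_sum]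
  simp only [zsmul_eq_mul]

theorem hermiteH_two_mul (m : ℕ) (x : ℝ) :
    hermiteH (2 * m) x = ∑ k ∈ Finset.range (m + 1),
      (-1) ^ (m - k) * ((2 * m).factorial : ℝ) * 2 ^ (2 * k) /
        ((m - k).factorial * (2 * k).factorial) * x ^ (2 * k) := by
  rw [hermiteH_eq_sum_range, sum_range_even]
  · refine Finset.sum_congr rfl fun k hk => ?_
    have hkm : k ≤ m := Nat.lt_succ_iff.1 (Finset.mem_range.1 hk)
    have h := hermiteH_term (m - k) (2 * k) x
    rwa [show 2 * (m - k) + 2 * k = 2 * m by omega] at h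
  · intro k
    rw [Polynomial.coeff_hermite_of_odd_add ⟨m + k, by ring⟩]
    simp

theorem hermiteH_two_mul_add_one (m : ℕ) (x : ℝ) :
    hermiteH (2 * m + 1) x = ∑ k ∈ Finset.range (m + 1),
      (-1) ^ (m - k) * ((2 * m + 1).factorial : ℝ) * 2 ^ (2 * k + 1) /
        ((m - k).factorial * (2 * k + 1).factorial) * x ^ (2 * k + 1) := by
  rw [hermiteH_eq_sum_range, sum_range_odd]
  · refine Finset.sum_congr rfl fun k hk => ?_
    have hkm : k ≤ m := Nat.lt_succ_iff.1 (Finset.mem_range.1 hk)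
    have h := hermiteH_term (m - k) (2 * k + 1) x
    rwa [show 2 * (m - k) + (2 * k + 1) = 2 * m + 1 by omega] at h
  · intro k
    rw [Polynomial.coeff_hermite_of_odd_add ⟨m + k, by ring⟩]
    simp

theorem integrableOn_pow_mul_bdd_mul_gaussian (p : ℕ) {g : ℝ → ℝ} (hg : Continuous g)
    (hb : ∀ u, |g u| ≤ 1) :
    IntegrableOn (fun u : ℝ => u ^ p * g u * Real.exp (-u ^ 2 / 2)) (Set.Ioi 0) := by
  refine ((integrableOn_pow_mul_gaussian_half p).mul_bdd (c := 1) hg.aestronglyMeasurable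
    (Eventually.of_forall hb)).congr (Eventually.of_forall fun u => ?_)
  simp only
  ring

/-- For even index the phase is (-1)^m i, so the real part selects minus the sine integral. The
Gamma duplication identity turns (2k)! into Γ(k + 1/2). -/
theorem hermiteHilbert_two_mul (m : ℕ) (x : ℝ) :
    hermiteHilbert (2 * m) x =
      -√2 * ((2 * m).factorial : ℝ) * x * Real.exp (-x ^ 2 / 2) *
        ∑ k ∈ Finset.range (m + 1),
          (-1) ^ k * 2 ^ k * confluentPhi (1 / 2 - k) (3 / 2) (x ^ 2 / 2) /
            (((m - k).factorial : ℝ) * Real.Gamma (k + 1 / 2)) := by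
  have hI : (-Complex.I) ^ (2 * m) = (((-1) ^ m : ℝ) : ℂ) := by
    rw [pow_mul, neg_sq, Complex.I_sq]; push_cast; rfl
  have e : ∀ u, hermiteFun (2 * m) u * Real.sin (x * u) = ∑ k ∈ Finset.range (m + 1),
      (-1) ^ (m - k) * ((2 * m).factorial : ℝ) * 2 ^ (2 * k) /
        ((m - k).factorial * (2 * k).factorial) *
          (u ^ (2 * k) * Real.sin (x * u) * Real.exp (-u ^ 2 / 2)) := fun u => by
    rw [hermiteFun, hermiteH_two_mul, Finset.mul_sum, Finset.sum_mul]
    exact Finset.sum_congr rfl fun k _ => by ring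
  rw [hermiteHilbert, hI, mul_assoc, Complex.re_ofReal_mul, Complex.I_mul_re,
    im_hermiteHalfFourier]
  simp_rw [e]
  rw [integral_finsetSum _ fun k _ => (integrableOn_pow_mul_bdd_mul_gaussian (2 * k)
    (g := fun u => Real.sin (x * u)) (by fun_prop) fun u => Real.abs_sin_le_one _).const_mul _]
  simp_rw [integral_const_mul, integral_pow_mul_sin_mul_gaussian]
  rw [← Finset.sum_neg_distrib, Finset.mul_sum, Finset.mul_sum, Finset.mul_sum]
  refine Finset.sum_congr rfl fun k hk => ?_
  have hkm : k ≤ m := Nat.lt_succ_iff.1 (Finset.mem_range.1 hk)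
  have hG := gamma_natCast_add_half k
  have hk0 : (k.factorial : ℝ) ≠ 0 := by positivity
  have hk2 : ((2 * k).factorial : ℝ) ≠ 0 := by positivity
  have hmk : ((m - k).factorial : ℝ) ≠ 0 := by positivity
  have hpi : √Real.pi ≠ 0 := by positivity
  have hG0 : Real.Gamma (k + 1 / 2) ≠ 0 := (Real.Gamma_pos_of_pos (by positivity)).ne'
  have hsgn : (-1 : ℝ) ^ m * (-1) ^ (m - k) = (-1) ^ k := by
    rw [← pow_add, show m + (m - k) = 2 * (m - k) + k by omega, pow_add, pow_mul]; simp
  generalize confluentPhi _ _ _ = Φ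
  generalize Real.Gamma (k + 1 / 2) = Γ at hG hG0 ⊢
  rw [Real.sqrt_div (by norm_num), ← hsgn, pow_mul, show (2 : ℝ) ^ 2 = 4 by norm_num]
  field_simp
  linear_combination (-Φ * x) * hG

/-- For odd index the phase is the real number (-1)^m, so the cosine integral is selected. -/
theorem hermiteHilbert_two_mul_add_one (m : ℕ) (x : ℝ) :
    hermiteHilbert (2 * m + 1) x =
      √2 * ((2 * m + 1).factorial : ℝ) * Real.exp (-x ^ 2 / 2) *
        ∑ k ∈ Finset.range (m + 1),
          (-1) ^ k * 2 ^ k * confluentPhi (-1 / 2 - k) (1 / 2) (x ^ 2 / 2) /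
            (((m - k).factorial : ℝ) * Real.Gamma (k + 3 / 2)) := by
  have hI : (-Complex.I) ^ (2 * m + 1) * Complex.I = (((-1) ^ m : ℝ) : ℂ) := by
    rw [pow_succ, pow_mul, neg_sq, mul_assoc, neg_mul, Complex.I_mul_I, Complex.I_sq]
    push_cast; ring
  have e : ∀ u, hermiteFun (2 * m + 1) u * Real.cos (x * u) = ∑ k ∈ Finset.range (m + 1),
      (-1) ^ (m - k) * ((2 * m + 1).factorial : ℝ) * 2 ^ (2 * k + 1) /
        ((m - k).factorial * (2 * k + 1).factorial) *
          (u ^ (2 * k + 1) * Real.cos (x * u) * Real.exp (-u ^ 2 / 2)) := fun u => by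
    rw [hermiteFun, hermiteH_two_mul_add_one, Finset.mul_sum, Finset.sum_mul]
    exact Finset.sum_congr rfl fun k _ => by ring
  rw [hermiteHilbert, hI, Complex.re_ofReal_mul, re_hermiteHalfFourier]
  simp_rw [e]
  rw [integral_finsetSum _ fun k _ => (integrableOn_pow_mul_bdd_mul_gaussian (2 * k + 1)
    (g := fun u => Real.cos (x * u)) (by fun_prop) fun u => Real.abs_cos_le_one _).const_mul _]
  simp_rw [integral_const_mul, integral_pow_mul_cos_mul_gaussian]
  rw [Finset.mul_sum, Finset.mul_sum, Finset.mul_sum]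
  refine Finset.sum_congr rfl fun k hk => ?_
  have hkm : k ≤ m := Nat.lt_succ_iff.1 (Finset.mem_range.1 hk)
  have hG := gamma_natCast_add_three_halves k
  have hk0 : (k.factorial : ℝ) ≠ 0 := by positivity
  have hk2 : ((2 * k + 1).factorial : ℝ) ≠ 0 := by positivity
  have hmk : ((m - k).factorial : ℝ) ≠ 0 := by positivity
  have hpi : √Real.pi ≠ 0 := by positivity
  have hG0 : Real.Gamma (k + 3 / 2) ≠ 0 := (Real.Gamma_pos_of_pos (by positivity)).ne'
  have hsgn : (-1 : ℝ) ^ m * (-1) ^ (m - k) = (-1) ^ k := by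
    rw [← pow_add, show m + (m - k) = 2 * (m - k) + k by omega, pow_add, pow_mul]; simp
  generalize confluentPhi _ _ _ = Φ
  generalize Real.Gamma (k + 3 / 2) = Γ at hG hG0 ⊢
  rw [Real.sqrt_div (by norm_num), ← hsgn, pow_succ 2 (2 * k), pow_mul,
    show (2 : ℝ) ^ 2 = 4 by norm_num]
  field_simp
  linear_combination Φ * hG

end ExplicitFormulas

/-! ### The L² inverse Fourier transform and the Fourier integral. -/

section FourierL2

open FourierTransform

theorem integral_fourierInv_smul_eq {f g : ℝ → ℂ} (hf : Integrable f) (hg : Integrable g) :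
    ∫ x, 𝓕⁻ f x • g x = ∫ x, f x • 𝓕⁻ g x := by
  have h := VectorFourier.integral_fourierIntegral_smul_eq_flip (e := Real.fourierChar)
    (μ := (volume : Measure ℝ)) (ν := (volume : Measure ℝ)) (L := -innerₗ ℝ) (f := f) (g := g)
    Real.continuous_fourierChar (by
      simp only [LinearMap.neg_apply, innerₗ_apply_apply]; fun_prop) hf hg
  have hL : (-innerₗ ℝ : ℝ →ₗ[ℝ] ℝ →ₗ[ℝ] ℝ).flip = -innerₗ ℝ := by
    ext; simp
  rw [hL] at h
  exact h

theorem continuous_fourierInv_of_integrable {h : ℝ → ℂ} (hh : Integrable h) :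
    Continuous (𝓕⁻ h) :=
  VectorFourier.fourierIntegral_continuous Real.continuous_fourierChar (by
      simp only [LinearMap.neg_apply, innerₗ_apply_apply]; fun_prop) hh

/-- On `L¹ ∩ L²` the inverse Fourier transform of `L²` is given by the Fourier integral. -/
theorem coeFn_fourierInv_toLp {h : ℝ → ℂ} (h1 : Integrable h) (h2 : MemLp h 2) :
    (𝓕⁻ (h2.toLp h) : Lp ℂ 2 (volume : Measure ℝ)) =ᵐ[volume] 𝓕⁻ h := by
  refine ae_eq_of_integral_contDiff_smul_eq
    ((Lp.memLp _).locallyIntegrable (by norm_num))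
    (continuous_fourierInv_of_integrable h1).locallyIntegrable fun g g_smooth g_cpt => ?_
  have hg₁ : HasCompactSupport (Complex.ofRealCLM ∘ g) := g_cpt.comp_left rfl
  have hg₂ : ContDiff ℝ (⊤ : ℕ∞) (Complex.ofRealCLM ∘ g) := by fun_prop
  set φ := hg₁.toSchwartzMap hg₂ with hφ
  have hφg : ∀ x, φ x = (g x : ℂ) := fun x => rfl
  -- As tempered distributions, both inverse transforms move onto the test function φ: the L² one by
  -- definition, the integral one by Fubini. Test functions determine a locally integrable function
  -- a.e.
  have e1 := congrArg (fun T => T φ)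
    (Lp.fourierInv_toTemperedDistribution_eq (E := ℝ) (F := ℂ) (h2.toLp h))
  simp only [TemperedDistribution.fourierInv_apply, Lp.toTemperedDistribution_apply] at e1
  have e2 : ∫ x, (𝓕⁻ φ : SchwartzMap ℝ ℂ) x • (h2.toLp h) x = ∫ x, 𝓕⁻ (φ : ℝ → ℂ) x • h x := by
    refine integral_congr_ae ?_
    filter_upwards [h2.coeFn_toLp] with x hx
    rw [hx, SchwartzMap.fourierInv_coe]
  rw [e2, integral_fourierInv_smul_eq φ.integrable h1] at e1
  simp only [hφg] at e1
  simpa using e1.symm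

theorem inner_fourierInv_left (f g : Lp ℂ 2 (volume : Measure ℝ)) :
    inner ℂ (𝓕⁻ f) g = inner ℂ f (𝓕 g) := by
  rw [← Lp.inner_fourier_eq, fourier_fourierInv_eq]

theorem inner_fourierInv_eq (f g : Lp ℂ 2 (volume : Measure ℝ)) :
    inner ℂ (𝓕⁻ f) (𝓕⁻ g) = inner ℂ f g := by
  rw [inner_fourierInv_left, fourier_fourierInv_eq]

theorem ae_eq_zero_of_fourierInv_eq_zero {h : ℝ → ℂ} (h1 : Integrable h) (h2 : MemLp h 2)
    (h0 : ∀ x, 𝓕⁻ h x = 0) : h =ᵐ[volume] 0 := by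
  have e : 𝓕⁻ (h2.toLp h) = 0 := by
    rw [Lp.eq_zero_iff_ae_eq_zero]
    filter_upwards [coeFn_fourierInv_toLp h1 h2] with x hx
    rw [hx, h0]; rfl
  have e' : h2.toLp h = 0 := (Lp.fourierTransformₗᵢ ℝ ℂ).symm.map_eq_zero_iff.1 e
  exact h2.coeFn_toLp.symm.trans ((Lp.eq_zero_iff_ae_eq_zero).1 e')

end FourierL2

/-! ### Completeness of the dilated Hermite functions. -/

section Completeness

open FourierTransform

theorem memLp_two_pow_mul_hermiteFun_comp_mul (n k : ℕ) {a : ℝ} (ha : a ≠ 0) :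
    MemLp (fun v : ℝ => (((a * v) ^ k * hermiteFun n (a * v) : ℝ) : ℂ)) 2 := by
  have hc := continuous_hermiteFun n
  have h : MemLp (fun v : ℝ => (a * v) ^ k * hermiteFun n (a * v)) 2 := by
    refine (memLp_two_iff_integrable_sq (by fun_prop)).2 ?_
    refine ((integrable_pow_mul_hermiteFun_mul_hermiteFun n n (2 * k)).comp_mul_left' ha).congr
      (Eventually.of_forall fun v => ?_)
    simp only
    ring
  exact h.ofReal

/-- The moments of an `L²` function against the Gaussian are determined by its Hermite
coefficients. -/
theorem integral_pow_mul_hermiteFun_mul_eq_zero {a : ℝ} (ha : a ≠ 0) {R : ℝ → ℂ} (hR : MemLp R 2)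
    (h : ∀ n, ∫ v, (hermiteFun n (a * v) : ℂ) * R v = 0) (k n : ℕ) :
    ∫ v, (((a * v) ^ k * hermiteFun n (a * v) : ℝ) : ℂ) * R v = 0 := by
  have hi : ∀ k n, Integrable fun v => (((a * v) ^ k * hermiteFun n (a * v) : ℝ) : ℂ) * R v :=
    fun k n => (memLp_two_pow_mul_hermiteFun_comp_mul n k ha).integrable_mul hR
  -- The recurrence y h_{n+1} = h_{n+2}/2 + (n+1) h_n trades a power of y = av for neighbouring
  -- indices.
  induction k generalizing n with
  | zero => simpa using h n
  | succ k ih =>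
    cases n with
    | zero =>
      have e : ∀ v, (((a * v) ^ (k + 1) * hermiteFun 0 (a * v) : ℝ) : ℂ) * R v =
          1 / 2 * ((((a * v) ^ k * hermiteFun 1 (a * v) : ℝ) : ℂ) * R v) := fun v => by
        rw [hermiteFun_one]; push_cast; ring
      simp_rw [e]
      rw [integral_const_mul, ih, mul_zero]
    | succ n =>
      have e : ∀ v, (((a * v) ^ (k + 1) * hermiteFun (n + 1) (a * v) : ℝ) : ℂ) * R v =
          1 / 2 * ((((a * v) ^ k * hermiteFun (n + 2) (a * v) : ℝ) : ℂ) * R v) +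
          (n + 1) * ((((a * v) ^ k * hermiteFun n (a * v) : ℝ) : ℂ) * R v) := fun v => by
        rw [hermiteFun_add_two]; push_cast; ring
      simp_rw [e]
      rw [integral_add ((hi k _).const_mul _) ((hi k _).const_mul _), integral_const_mul,
        integral_const_mul, ih, ih, mul_zero, mul_zero, add_zero]

theorem memLp_two_exp_neg_mul_sq {b : ℝ} (hb : 0 < b) :
    MemLp (fun v : ℝ => Real.exp (-b * v ^ 2)) 2 := by
  refine (memLp_two_iff_integrable_sq (by fun_prop)).2 ?_
  refine (integrable_exp_neg_mul_sq (b := 2 * b) (by linarith)).congr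
    (Eventually.of_forall fun v => ?_)
  simp only [← Real.exp_nat_mul]
  push_cast
  ring_nf

/-- With y = av, completing the square gives |cy| - y²/2 ≤ c² - y²/4, and the Gaussian left over is
in L². This dominates the exponential series of the Fourier kernel. -/
theorem integrable_exp_abs_mul_gaussian_mul {a : ℝ} (ha : a ≠ 0) {R : ℝ → ℂ} (hR : MemLp R 2)
    (c : ℝ) :
    Integrable fun v => Real.exp |c * (a * v)| * ‖(hermiteFun 0 (a * v) : ℂ) * R v‖ := by
  have hc := continuous_hermiteFun 0
  have ha2 : 0 < a ^ 2 / 4 := by positivity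
  have h1 : Integrable fun v => Real.exp (-(a ^ 2 / 4) * v ^ 2) * ‖R v‖ :=
    (memLp_two_exp_neg_mul_sq ha2).integrable_mul hR.norm
  refine (h1.const_mul (Real.exp (c ^ 2))).mono' ?_ (Eventually.of_forall fun v => ?_)
  · have hm := hR.aestronglyMeasurable
    exact (Continuous.aestronglyMeasurable (by fun_prop)).mul
      ((Continuous.aestronglyMeasurable (by fun_prop)).mul hm).norm
  · rw [norm_mul, norm_norm, norm_mul, Complex.norm_real, hermiteFun_zero,
      Real.norm_of_nonneg (Real.exp_nonneg _), Real.norm_of_nonneg (Real.exp_nonneg _),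
      ← mul_assoc, ← mul_assoc (Real.exp (c ^ 2)), ← Real.exp_add, ← Real.exp_add]
    refine mul_le_mul_of_nonneg_right (Real.exp_le_exp.2 ?_) (norm_nonneg _)
    rcases abs_cases (c * (a * v)) with ⟨h, _⟩ | ⟨h, _⟩ <;> rw [h] <;>
      nlinarith [sq_nonneg (c - a * v / 2), sq_nonneg (c + a * v / 2)]

/-- Completeness of the (dilated) Hermite functions in `L²`. -/
theorem ae_eq_zero_of_integral_hermiteFun_mul_eq_zero {a : ℝ} (ha : a ≠ 0) {R : ℝ → ℂ}
    (hR : MemLp R 2) (h : ∀ n, ∫ v, (hermiteFun n (a * v) : ℂ) * R v = 0) :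
    R =ᵐ[volume] 0 := by
  have hc := continuous_hermiteFun 0
  set w : ℝ → ℂ := fun v => (hermiteFun 0 (a * v) : ℂ) * R v with hw
  have hmom : ∀ k, ∫ v, ((a * v : ℝ) : ℂ) ^ k * w v = 0 := fun k => by
    rw [← integral_pow_mul_hermiteFun_mul_eq_zero ha hR h k 0]
    refine integral_congr_ae (Eventually.of_forall fun v => ?_)
    simp only [hw]; push_cast; ring
  have hwm : AEStronglyMeasurable w :=
    (Continuous.aestronglyMeasurable (by fun_prop)).mul hR.aestronglyMeasurable
  have hw1 : Integrable w := by
    refine (integrable_norm_iff hwm).1 ?_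
    simpa [hw] using integrable_exp_abs_mul_gaussian_mul ha hR 0
  have hw2 : MemLp w 2 := by
    refine hR.mono hwm (Eventually.of_forall fun v => ?_)
    rw [hw, norm_mul, Complex.norm_real, hermiteFun_zero, Real.norm_of_nonneg (Real.exp_nonneg _)]
    refine mul_le_of_le_one_left (norm_nonneg _) (Real.exp_le_one_iff.2 ?_)
    nlinarith [sq_nonneg (a * v)]
  have hF : ∀ x, 𝓕⁻ w x = 0 := fun x => by
    -- Chosen so that the Fourier exponent 2πi xv equals ic(av). Expanding the exponential makes the
    -- transform of w a series of vanishing moments.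
    set c : ℝ := 2 * Real.pi * x / a with hcdef
    have hexp : ∀ v : ℝ, HasSum (fun k : ℕ => (Complex.I * c) ^ k / k.factorial *
        (((a * v : ℝ) : ℂ) ^ k * w v))
        (Complex.exp ((2 * Real.pi * inner ℝ v x : ℝ) * Complex.I) • w v) := fun v => by
      have := (NormedSpace.expSeries_div_hasSum_exp
        (((2 * Real.pi * inner ℝ v x : ℝ) : ℂ) * Complex.I)).mul_right (w v)
      rw [← Complex.exp_eq_exp_ℂ] at this
      convert! this using 2 with k
      rw [← mul_assoc, div_mul_eq_mul_div, ← mul_pow]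
      congr 3
      rw [hcdef, show inner ℝ v x = x * v from rfl]
      push_cast
      have : (a : ℂ) ≠ 0 := by exact_mod_cast ha
      field_simp
    have hb : ∀ v : ℝ, HasSum (fun k : ℕ => |c * (a * v)| ^ k / k.factorial * ‖w v‖)
        (Real.exp |c * (a * v)| * ‖w v‖) := fun v => by
      rw [Real.exp_eq_exp_ℝ]
      exact (NormedSpace.expSeries_div_hasSum_exp |c * (a * v)|).mul_right _
    have hs := hasSum_integral_of_dominated_convergence (μ := (volume : Measure ℝ))
      (F := fun (k : ℕ) (v : ℝ) => (Complex.I * c) ^ k / k.factorial *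
        (((a * v : ℝ) : ℂ) ^ k * w v))
      (fun k v => |c * (a * v)| ^ k / k.factorial * ‖w v‖)
      (fun k => by
        exact ((Continuous.aestronglyMeasurable (by fun_prop)).mul hwm).const_mul _)
      (fun k => Eventually.of_forall fun v => le_of_eq ?_)
      (Eventually.of_forall fun v => (hb v).summable)
      (by
        simp_rw [(hb _).tsum_eq]
        exact integrable_exp_abs_mul_gaussian_mul ha hR c)
      (Eventually.of_forall hexp)
    · simp_rw [integral_const_mul, hmom, mul_zero] at hs
      rw [Real.fourierInv_eq']
      exact hs.unique hasSum_zero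
    · simp only [norm_mul, norm_div, norm_pow, Complex.norm_I, Complex.norm_real,
        Complex.norm_natCast, Real.norm_eq_abs, abs_mul, mul_pow]
      ring
  filter_upwards [ae_eq_zero_of_fourierInv_eq_zero hw1 hw2 hF] with v hv
  have h0 : (hermiteFun 0 (a * v) : ℂ) ≠ 0 := by
    rw [hermiteFun_zero]
    exact_mod_cast Real.exp_ne_zero _
  exact (mul_eq_zero.1 hv).resolve_left h0

end Completeness

/-! ### Plancherel: orthogonality and completeness of the transforms. -/

section HermiteHilbertL2

open FourierTransform ComplexConjugate

/-- The sign function with the value `-1` at the origin. -/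
noncomputable def halfLineSign (v : ℝ) : ℝ := if 0 < v then 1 else -1

theorem measurable_halfLineSign : Measurable halfLineSign :=
  Measurable.ite measurableSet_Ioi measurable_const measurable_const

theorem halfLineSign_mul_self (v : ℝ) : halfLineSign v * halfLineSign v = 1 := by
  unfold halfLineSign; split_ifs <;> norm_num

theorem norm_halfLineSign (v : ℝ) : ‖halfLineSign v‖ = 1 := by
  unfold halfLineSign; split_ifs <;> norm_num

/-- The phase of the Fourier transform of the Hilbert transform of a Hermite function. -/
noncomputable def hermitePhase (n : ℕ) : ℂ := (-Complex.I) ^ n * Complex.I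

theorem conj_hermitePhase (n : ℕ) : conj (hermitePhase n) = -(-1) ^ n * hermitePhase n := by
  rw [hermitePhase, map_mul, map_pow, map_neg, Complex.conj_I, neg_neg, neg_pow Complex.I n,
    ← mul_assoc, mul_neg, neg_mul, neg_mul, ← mul_assoc, ← mul_pow]
  norm_num

theorem conj_hermitePhase_mul_self (n : ℕ) : conj (hermitePhase n) * hermitePhase n = 1 := by
  rw [mul_comm, Complex.mul_conj, Complex.normSq_eq_norm_sq, hermitePhase]
  simp

/-- The Fourier transform of the Hilbert transform of the `n`-th Hermite function. -/
noncomputable def hermiteSymbol (n : ℕ) (v : ℝ) : ℂ :=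
  √(2 * Real.pi) * hermitePhase n * (halfLineSign v * hermiteFun n (2 * Real.pi * v) : ℝ)

theorem two_pi_ne_zero : (2 * Real.pi : ℝ) ≠ 0 := by positivity

theorem integrable_hermiteSymbol (n : ℕ) : Integrable (hermiteSymbol n) := by
  have h : Integrable fun v => halfLineSign v * hermiteFun n (2 * Real.pi * v) :=
    ((integrable_hermiteFun n).comp_mul_left' two_pi_ne_zero).bdd_mul (c := 1)
      measurable_halfLineSign.aestronglyMeasurable
      (Eventually.of_forall fun v => (norm_halfLineSign v).le)
  exact h.ofReal.const_mul _

theorem memLp_hermiteSymbol (n : ℕ) : MemLp (hermiteSymbol n) 2 := by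
  refine (memLp_two_iff_integrable_sq_norm
    (integrable_hermiteSymbol n).aestronglyMeasurable).2 ?_
  refine (((integrable_hermiteFun_mul_hermiteFun n n).comp_mul_left' two_pi_ne_zero).const_mul
    (‖(√(2 * Real.pi) : ℂ) * hermitePhase n‖ ^ 2)).congr (Eventually.of_forall fun v => ?_)
  simp only [hermiteSymbol]
  rw [norm_mul _ ((_ : ℝ) : ℂ), Complex.norm_real, norm_mul (halfLineSign v), norm_halfLineSign,
    one_mul, mul_pow, Real.norm_eq_abs, sq_abs, sq (hermiteFun n _)]

theorem hermiteHalfFourier_neg (n : ℕ) (x : ℝ) :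
    hermiteHalfFourier n (-x) = conj (hermiteHalfFourier n x) := by
  rw [hermiteHalfFourier, hermiteHalfFourier, ← integral_conj]
  refine integral_congr_ae (Eventually.of_forall fun u => ?_)
  simp only [map_mul, Complex.conj_ofReal, ← Complex.exp_conj, Complex.conj_I]
  push_cast
  ring_nf

theorem setIntegral_Ioi_hermiteFun_dilate (n : ℕ) (x : ℝ) :
    ∫ v in Set.Ioi (0 : ℝ), (hermiteFun n (2 * Real.pi * v) : ℂ) *
      Complex.exp (Complex.I * (x * (2 * Real.pi * v : ℝ))) =
      (2 * Real.pi : ℂ)⁻¹ * hermiteHalfFourier n x := by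
  have h := integral_comp_mul_left_Ioi (fun u : ℝ => (hermiteFun n u : ℂ) *
    Complex.exp (Complex.I * (x * u))) 0 (b := 2 * Real.pi) (by positivity)
  rw [mul_zero] at h
  rw [h, hermiteHalfFourier, Complex.real_smul]
  push_cast
  rfl

/-- On the negative half-line the sign and the parity of h_n contribute -(-1)^n, exactly the factor
by which conjugation changes the phase. The two halves are thus conjugate and add to twice a real
part; the constants agree since 2√(2π)/(2π) = √(2/π). -/
theorem fourierInv_hermiteSymbol (n : ℕ) (x : ℝ) :
    𝓕⁻ (hermiteSymbol n) x = (hermiteHilbert n x : ℂ) := by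
  set E : ℝ → ℂ := fun v =>
    Complex.exp ((2 * Real.pi * inner ℝ v x : ℝ) * Complex.I) • hermiteSymbol n v with hE
  set C : ℂ := √(2 * Real.pi) * hermitePhase n with hC
  have hEi : Integrable E := by
    refine (integrable_hermiteSymbol n).bdd_mul (c := 1)
      (Continuous.aestronglyMeasurable (by fun_prop)) (Eventually.of_forall fun v => ?_)
    rw [Complex.norm_exp_ofReal_mul_I]
  have hpos : ∫ v in Set.Ioi (0 : ℝ), E v =
      C * ((2 * Real.pi : ℂ)⁻¹ * hermiteHalfFourier n x) := by
    rw [← setIntegral_Ioi_hermiteFun_dilate, ← integral_const_mul]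
    refine setIntegral_congr_fun measurableSet_Ioi fun v hv => ?_
    simp only [hE, hermiteSymbol, halfLineSign, if_pos (Set.mem_Ioi.1 hv), one_mul, smul_eq_mul,
      hC, show inner ℝ v x = x * v from rfl]
    push_cast
    ring_nf
  have hneg : ∫ v in Set.Iic (0 : ℝ), E v =
      C * (-(-1) ^ n * ((2 * Real.pi : ℂ)⁻¹ * hermiteHalfFourier n (-x))) := by
    have h := integral_comp_neg_Ioi (0 : ℝ) E
    rw [neg_zero] at h
    rw [← h, ← setIntegral_Ioi_hermiteFun_dilate, ← integral_const_mul, ← integral_const_mul]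
    refine setIntegral_congr_fun measurableSet_Ioi fun v hv => ?_
    have hv' : ¬ 0 < -v := by have := Set.mem_Ioi.1 hv; linarith
    simp only [hE, hermiteSymbol, halfLineSign, if_neg hv', smul_eq_mul,
      hC, show inner ℝ (-v) x = x * -v from rfl, mul_neg, hermiteFun_neg]
    push_cast
    ring_nf
  have hsum : 𝓕⁻ (hermiteSymbol n) x = (∫ v in Set.Iic (0 : ℝ), E v) +
      ∫ v in Set.Ioi (0 : ℝ), E v := by
    rw [Real.fourierInv_eq', ← setIntegral_univ, ← Set.Iic_union_Ioi (a := (0 : ℝ)),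
      setIntegral_union (Set.Iic_disjoint_Ioi le_rfl) measurableSet_Ioi hEi.integrableOn
        hEi.integrableOn]
  have hconj : -(-1) ^ n * hermitePhase n * conj (hermiteHalfFourier n x) =
      conj (hermitePhase n * hermiteHalfFourier n x) := by
    rw [map_mul, conj_hermitePhase]
  have hre := Complex.add_conj (hermitePhase n * hermiteHalfFourier n x)
  have hpi : (Real.pi : ℂ) ≠ 0 := by exact_mod_cast Real.pi_ne_zero
  rw [hsum, hpos, hneg, hermiteHalfFourier_neg, hermiteHilbert, sqrt_two_div_pi_eq,
    show (-Complex.I) ^ n * Complex.I = hermitePhase n from rfl]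
  rw [← hconj] at hre
  push_cast at hre ⊢
  rw [hC]
  field_simp
  linear_combination hre

theorem coeFn_fourierInv_toLp_hermiteSymbol (n : ℕ) :
    (𝓕⁻ ((memLp_hermiteSymbol n).toLp) : Lp ℂ 2 (volume : Measure ℝ)) =ᵐ[volume]
      fun x => (hermiteHilbert n x : ℂ) := by
  filter_upwards [coeFn_fourierInv_toLp (integrable_hermiteSymbol n) (memLp_hermiteSymbol n)]
    with x hx
  rw [hx, fourierInv_hermiteSymbol]

theorem memLp_hermiteHilbert (n : ℕ) : MemLp (hermiteHilbert n) 2 :=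
  ((memLp_congr_ae (coeFn_fourierInv_toLp_hermiteSymbol n)).1 (Lp.memLp _)).re

/-- The signs square to 1, and √(2π)² cancels the Jacobian of u = 2πv. -/
theorem integral_conj_hermiteSymbol_mul (n m : ℕ) :
    ∫ v, conj (hermiteSymbol n v) * hermiteSymbol m v =
      conj (hermitePhase n) * hermitePhase m * (∫ x, hermiteFun n x * hermiteFun m x : ℝ) := by
  have h2 : ((√(2 * Real.pi) : ℝ) : ℂ) * (√(2 * Real.pi) : ℝ) = 2 * Real.pi := by
    rw [← Complex.ofReal_mul, Real.mul_self_sqrt (by positivity)]; push_cast; rfl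
  have e : ∀ v, conj (hermiteSymbol n v) * hermiteSymbol m v =
      conj (hermitePhase n) * hermitePhase m * (2 * Real.pi) *
        ((hermiteFun n (2 * Real.pi * v) * hermiteFun m (2 * Real.pi * v) : ℝ) : ℂ) := fun v => by
    have hs : ((halfLineSign v : ℝ) : ℂ) * halfLineSign v = 1 := by
      rw [← Complex.ofReal_mul, halfLineSign_mul_self, Complex.ofReal_one]
    simp only [hermiteSymbol, map_mul, Complex.conj_ofReal, Complex.ofReal_mul]
    linear_combination (conj (hermitePhase n) * hermitePhase m *
      hermiteFun n (2 * Real.pi * v) * hermiteFun m (2 * Real.pi * v)) *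
      (halfLineSign v * halfLineSign v * h2 + 2 * Real.pi * hs)
  have hpi : (Real.pi : ℂ) ≠ 0 := by exact_mod_cast Real.pi_ne_zero
  simp_rw [e]
  rw [integral_const_mul, integral_complex_ofReal,
    Measure.integral_comp_mul_left (fun u => hermiteFun n u * hermiteFun m u),
    abs_of_pos (by positivity), smul_eq_mul]
  push_cast
  field_simp

theorem integral_hermiteHilbert_mul_hermiteHilbert (n m : ℕ) :
    ∫ x, hermiteHilbert n x * hermiteHilbert m x =
      if m = n then √Real.pi * 2 ^ n * (n.factorial : ℝ) else 0 := by
  have h := inner_fourierInv_eq ((memLp_hermiteSymbol n).toLp) ((memLp_hermiteSymbol m).toLp)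
  rw [L2.inner_def, L2.inner_def] at h
  have e1 : ∫ x, inner ℂ ((𝓕⁻ ((memLp_hermiteSymbol n).toLp) : Lp ℂ 2 (volume : Measure ℝ)) x)
      ((𝓕⁻ ((memLp_hermiteSymbol m).toLp) : Lp ℂ 2 (volume : Measure ℝ)) x) =
      ((∫ x, hermiteHilbert n x * hermiteHilbert m x : ℝ) : ℂ) := by
    rw [← integral_complex_ofReal]
    refine integral_congr_ae ?_
    filter_upwards [coeFn_fourierInv_toLp_hermiteSymbol n, coeFn_fourierInv_toLp_hermiteSymbol m]
      with x h1 h2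
    rw [h1, h2, RCLike.inner_apply, Complex.conj_ofReal]
    push_cast
    exact mul_comm _ _
  have e2 : ∫ x, inner ℂ (((memLp_hermiteSymbol n).toLp) x) (((memLp_hermiteSymbol m).toLp) x) =
      ∫ v, conj (hermiteSymbol n v) * hermiteSymbol m v := by
    refine integral_congr_ae ?_
    filter_upwards [(memLp_hermiteSymbol n).coeFn_toLp, (memLp_hermiteSymbol m).coeFn_toLp]
      with x h1 h2
    rw [h1, h2, RCLike.inner_apply, mul_comm]
  rw [e1, e2, integral_conj_hermiteSymbol_mul, integral_hermiteFun_mul_hermiteFun] at h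
  by_cases hmn : m = n
  · subst hmn
    rw [conj_hermitePhase_mul_self, one_mul] at h
    exact Complex.ofReal_injective h
  · rw [if_neg hmn, Complex.ofReal_zero, mul_zero] at h
    rw [if_neg hmn]
    exact Complex.ofReal_injective h

/-- An `L²` function that is orthogonal to the Hilbert transforms of all Hermite functions
vanishes. -/
theorem ae_eq_zero_of_integral_hermiteHilbert_mul_eq_zero {q : ℝ → ℝ} (hq : MemLp q 2)
    (h : ∀ n, ∫ x, hermiteHilbert n x * q x = 0) : q =ᵐ[volume] 0 := by
  have hqc : MemLp (fun x => (q x : ℂ)) 2 := hq.ofReal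
  set Q : Lp ℂ 2 (volume : Measure ℝ) := 𝓕 hqc.toLp with hQ
  have hsm : AEStronglyMeasurable (fun v => (halfLineSign v : ℂ)) volume :=
    (Complex.measurable_ofReal.comp measurable_halfLineSign).aestronglyMeasurable
  have hR : MemLp (fun v => (halfLineSign v : ℂ) * Q v) 2 := by
    refine (Lp.memLp Q).mono (hsm.mul (Lp.aestronglyMeasurable Q))
      (Eventually.of_forall fun v => ?_)
    rw [norm_mul, Complex.norm_real, norm_halfLineSign, one_mul]
  -- Plancherel moves the orthogonality to the frequency side; the sign in the symbol is grouped
  -- with Q, leaving a plain dilated Hermite function.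
  have horth : ∀ n, ∫ v, (hermiteFun n (2 * Real.pi * v) : ℂ) *
      ((halfLineSign v : ℂ) * Q v) = 0 := fun n => by
    have h1 := inner_fourierInv_left ((memLp_hermiteSymbol n).toLp) hqc.toLp
    rw [L2.inner_def, L2.inner_def] at h1
    have e1 : ∫ x, inner ℂ ((𝓕⁻ ((memLp_hermiteSymbol n).toLp) : Lp ℂ 2 (volume : Measure ℝ)) x)
        ((hqc.toLp : Lp ℂ 2 (volume : Measure ℝ)) x) = 0 := by
      rw [← Complex.ofReal_zero, ← h n, ← integral_complex_ofReal]
      refine integral_congr_ae ?_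
      filter_upwards [coeFn_fourierInv_toLp_hermiteSymbol n, hqc.coeFn_toLp] with x h2 h3
      rw [h2, h3, RCLike.inner_apply, Complex.conj_ofReal]
      push_cast
      exact mul_comm _ _
    have e2 : ∫ v, inner ℂ (((memLp_hermiteSymbol n).toLp) v) (Q v) =
        (√(2 * Real.pi) * conj (hermitePhase n)) *
          ∫ v, (hermiteFun n (2 * Real.pi * v) : ℂ) * ((halfLineSign v : ℂ) * Q v) := by
      rw [← integral_const_mul]
      refine integral_congr_ae ?_
      filter_upwards [(memLp_hermiteSymbol n).coeFn_toLp] with v h2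
      rw [h2, RCLike.inner_apply, hermiteSymbol]
      simp only [map_mul, Complex.conj_ofReal, Complex.ofReal_mul]
      ring
    rw [e1, e2] at h1
    refine (mul_eq_zero.1 h1.symm).resolve_left (mul_ne_zero ?_ ?_)
    · exact_mod_cast (show √(2 * Real.pi) ≠ 0 by positivity)
    · exact left_ne_zero_of_mul_eq_one (conj_hermitePhase_mul_self n)
  have hQ0 : Q = 0 := by
    rw [Lp.eq_zero_iff_ae_eq_zero]
    filter_upwards [ae_eq_zero_of_integral_hermiteFun_mul_eq_zero two_pi_ne_zero hR horth] with v hv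
    refine (mul_eq_zero.1 hv).resolve_left fun h0 => ?_
    have := norm_halfLineSign v
    rw [Complex.ofReal_eq_zero.1 h0, norm_zero] at this
    exact zero_ne_one this
  have hq0 : hqc.toLp = 0 := (Lp.fourierTransformₗᵢ ℝ ℂ).map_eq_zero_iff.1 hQ0
  filter_upwards [hqc.coeFn_toLp, (Lp.eq_zero_iff_ae_eq_zero).1 hq0] with x h1 h2
  rw [h1] at h2
  exact Complex.ofReal_eq_zero.1 h2

theorem inner_toLp_hermiteHilbert (n : ℕ) {g : ℝ → ℝ} (hg : MemLp g 2) :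
    inner ℝ ((memLp_hermiteHilbert n).toLp) (hg.toLp) = ∫ x, hermiteHilbert n x * g x := by
  rw [L2.inner_def]
  refine integral_congr_ae ?_
  filter_upwards [(memLp_hermiteHilbert n).coeFn_toLp, hg.coeFn_toLp] with x h1 h2
  rw [h1, h2]
  exact mul_comm _ _

theorem isCompleteOrthogonalSystem_hermiteHilbert :
    IsCompleteOrthogonalSystem hermiteHilbert := by
  refine ⟨memLp_hermiteHilbert, fun n h0 => ?_, fun m n hmn => ?_, ?_⟩
  · have h := inner_toLp_hermiteHilbert n (memLp_hermiteHilbert n)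
    rw [integral_hermiteHilbert_mul_hermiteHilbert, if_pos rfl, h0, inner_zero_left] at h
    exact (show √Real.pi * 2 ^ n * (n.factorial : ℝ) ≠ 0 by positivity) h.symm
  · rw [inner_toLp_hermiteHilbert, integral_hermiteHilbert_mul_hermiteHilbert, if_neg hmn.symm]
  -- In a Hilbert space, a subspace is dense exactly when its orthogonal complement is trivial.
  · rw [Submodule.topologicalClosure_eq_top_iff, Submodule.eq_bot_iff]
    intro q hq
    rw [Submodule.mem_orthogonal] at hq
    rw [Lp.eq_zero_iff_ae_eq_zero]
    refine ae_eq_zero_of_integral_hermiteHilbert_mul_eq_zero (Lp.memLp q) fun n => ?_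
    rw [← inner_toLp_hermiteHilbert n (Lp.memLp q), Lp.toLp_coeFn]
    exact hq _ (Submodule.subset_span ⟨n, rfl⟩)

end HermiteHilbertL2

theorem theorem2p1 :
    (∀ (n : ℕ) (x : ℝ), HasHilbertTransformAt (hermiteFun n) x (hermiteG n x)) ∧
    IsCompleteOrthogonalSystem hermiteG ∧
    (∀ n m : ℕ, Integrable (fun x : ℝ => hermiteG n x * hermiteG m x) ∧
      ∫ x : ℝ, hermiteG n x * hermiteG m x =
        if m = n then √Real.pi * 2 ^ n * (n.factorial : ℝ) else 0) ∧
    (∀ (m : ℕ) (x : ℝ),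
      hermiteG (2 * m) x =
        -√2 * ((2 * m).factorial : ℝ) * x * Real.exp (-x ^ 2 / 2) *
          ∑ k ∈ Finset.range (m + 1),
            (-1) ^ k * 2 ^ k * confluentPhi (1 / 2 - k) (3 / 2) (x ^ 2 / 2) /
              (((m - k).factorial : ℝ) * Real.Gamma (k + 1 / 2))) ∧
    (∀ (m : ℕ) (x : ℝ),
      hermiteG (2 * m + 1) x =
        √2 * ((2 * m + 1).factorial : ℝ) * Real.exp (-x ^ 2 / 2) *
          ∑ k ∈ Finset.range (m + 1),
            (-1) ^ k * 2 ^ k * confluentPhi (-1 / 2 - k) (1 / 2) (x ^ 2 / 2) /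
              (((m - k).factorial : ℝ) * Real.Gamma (k + 3 / 2))) := by
  have hG : hermiteG = hermiteHilbert := funext hermiteG_eq
  rw [hG]
  exact ⟨hasHilbertTransformAt_hermiteFun, isCompleteOrthogonalSystem_hermiteHilbert,
    fun n m => ⟨(memLp_hermiteHilbert n).integrable_mul (memLp_hermiteHilbert m),
      integral_hermiteHilbert_mul_hermiteHilbert n m⟩,
    hermiteHilbert_two_mul, hermiteHilbert_two_mul_add_one⟩
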